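/- Let $\alpha>0$ be a constant and let $(m_k)$, $(n_k)$ be sequences of natural numbers with $n_k\to\infty$ and $m_k/n_k\to\alpha$ (in particular this covers $m_k=\alpha n_k$). For each $k$ let $H_k$ be an $m_k\times n_k$ random matrix, on some probability space, with i.i.d. standard normal entries, and put $$\xi_k=\min_{x\in\{-1/\sqrt{n_k},\,1/\sqrt{n_k}\}^{n_k}}\|H_kx\|_2 .$$ (i) Let $\epsilon_1,\epsilon_2,\epsilon_3>0$ be constants (independent of $k$) and let $\xi^{(l)}_k$ be real numbers such that, for all sufficiently large $k$, $$\frac{\xi^{(l)}_k}{\sqrt{n_k}}<(1-\epsilon_1)\sqrt{\alpha}-(1+\epsilon_2)\sqrt{\frac{2}{\pi}}-\epsilon_3 .$$ Then $\lim_{k\to\infty}P(\xi_k\ge\xi^{(l)}_k)=1$. If moreover $\xi^{(l)}_k\ge 0$ for all sufficiently large $k$, then also $\lim_{k\to\infty}P\big(\xi_k^2\ge(\xi^{(l)}_k)^2\big)=1$. (ii) For every $k$ with $m_k,n_k\ge 1$, $\xi_k$ is integrable and $$\frac{E\,\xi_k}{\sqrt{n_k}}\ \ge\ \sqrt{\frac{m_k}{n_k}}-\frac{1}{4\sqrt{m_kn_k}}-\sqrt{\frac{2}{\pi}}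 .$$ In particular, if $m_k=\alpha n_k$, then $$\frac{E\,\xi_k}{\sqrt{n_k}}\ \ge\ \sqrt{\alpha}-\frac{1}{4\sqrt{m_kn_k}}-\sqrt{\frac{2}{\pi}} .$$ -/

import Mathlib

open MeasureTheory ProbabilityTheory Filter Topology

/-- The scaled hypercube `{-1/√n, 1/√n}ⁿ`. -/
def scaledCube (n : ℕ) : Set (Fin n → ℝ) :=
  {x | ∀ i, x i = -(1 / √(n : ℝ)) ∨ x i = 1 / √(n : ℝ)}

/-- The Euclidean norm `‖A x‖₂`. -/
noncomputable def mulVecNorm {m n : ℕ} (A : Matrix (Fin m) (Fin n) ℝ) (x : Fin n → ℝ) : ℝ :=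
  ‖WithLp.toLp 2 (A.mulVec x)‖

/-- The minimum of `‖A x‖₂` over the scaled hypercube; the infimum is attained, see
`isLeast_cubeMin`. -/
noncomputable def cubeMin {m n : ℕ} (A : Matrix (Fin m) (Fin n) ℝ) : ℝ :=
  sInf (mulVecNorm A '' scaledCube n)

theorem scaledCube_finite (n : ℕ) : (scaledCube n).Finite := by
  have h : scaledCube n ⊆ Set.pi Set.univ
      (fun _ => ({-(1 / √(n : ℝ)), 1 / √(n : ℝ)} : Set ℝ)) := by
    intro x hx i _
    simpa using hx i
  exact (Set.Finite.pi fun _ => Set.toFinite _).subset h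

theorem scaledCube_nonempty (n : ℕ) : (scaledCube n).Nonempty :=
  ⟨fun _ => 1 / √(n : ℝ), fun _ => Or.inr rfl⟩

theorem isLeast_cubeMin {m n : ℕ} (A : Matrix (Fin m) (Fin n) ℝ) :
    IsLeast (mulVecNorm A '' scaledCube n) (cubeMin A) := by
  have hf := (scaledCube_finite n).image (mulVecNorm A)
  exact ⟨((scaledCube_nonempty n).image _).csInf_mem hf,
    fun _ hy => csInf_le hf.bddBelow hy⟩

/-- The random matrix `H` has i.i.d. standard normal entries under `P`. -/
structure IsStdGaussianMatrix {Ω : Type*} [MeasurableSpace Ω] {m n : ℕ}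
    (H : Ω → Matrix (Fin m) (Fin n) ℝ) (P : Measure Ω) : Prop where
  indep : iIndepFun (fun (p : Fin m × Fin n) (ω : Ω) => H ω p.1 p.2) P
  law : ∀ i j, HasLaw (fun ω => H ω i j) (gaussianReal 0 1) P

/-! The proof is Gordon's comparison method. Besides the matrix `H` take an independent scalar `γ`
and Gaussian vectors `g`, `h`. On unit vectors `x`, the process `‖H x‖ + γ` is compared with `‖g‖ +
⟨h, x⟩`: for every `t`, the event that all values exceed `t` is at least as likely for the first as
for the second (`gordon_comparison`). On the cube every `|x j|` is `1/√n`, so the second process is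
at least `‖g‖ - (∑ |h j|)/√n`, whose mean is `E‖g‖ - √n √(2/π)` (`gordon_cubeMin`).

The comparison is proved by rotating one Gaussian family into the other and differentiating in the
angle. Stein's identity turns the derivative into a difference of second-order terms
(`gaussian_comparison`). For a product of smoothed indicators the diagonal terms cancel and the
others have a sign, because `(1 - c)(1 - S) ≥ 0` for two inner products `c, S ≤ 1`
(`gordon_smooth`). Working with vectors `H x` and a smoothed norm means that only the finite set of
`x` has to be indexed, not the sphere dual to the norm.

Integrating the tail inequality bounds the mean, since `γ` is centred. Chebyshev's inequality for
`‖g‖`, `∑ |h j|` and `γ` bounds the lower tail. Both use the sharp estimate `E‖g‖ ≥ √m - 1/(4√m)`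
(`le_chiMean`), obtained from the recursion `E‖g_m‖ · E‖g_{m+1}‖ = m`. -/

/-- The standard Gaussian measure on `ι → ℝ`. -/
noncomputable abbrev stdGaussianPi (ι : Type*) [Fintype ι] : Measure (ι → ℝ) :=
  Measure.pi fun _ : ι => gaussianReal 0 1

/-! ### Gaussian integration by parts. -/

/-- The density satisfies `p' = -x p`, so this is integration by parts; boundedness of `g` and `g'`
supplies the integrability. -/
theorem stein_gaussianReal {g g' : ℝ → ℝ} {C D : ℝ} (hg : ∀ x, HasDerivAt g (g' x) x)
    (hC : ∀ x, |g x| ≤ C) (hD : ∀ x, |g' x| ≤ D) :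
    ∫ x, x * g x ∂(gaussianReal 0 1) = ∫ x, g' x ∂(gaussianReal 0 1) := by
  have hp : ∀ x, HasDerivAt (gaussianPDFReal 0 1) (-x * gaussianPDFReal 0 1 x) x := by
    intro x
    have h := (((hasDerivAt_pow 2 x).neg.div_const 2).exp).const_mul (√(2 * Real.pi))⁻¹
    have e : gaussianPDFReal 0 1 = fun x => (√(2 * Real.pi))⁻¹ * Real.exp (-x ^ 2 / 2) := by
      ext y; simp [gaussianPDFReal]
    rw [e]
    refine h.congr_deriv ?_
    simp only [Pi.neg_apply, Nat.cast_ofNat]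
    ring
  have hgm : Measurable g := (continuous_iff_continuousAt.2 fun x => (hg x).continuousAt).measurable
  have hg'm : Measurable g' := by
    have : g' = deriv g := funext fun x => (hg x).deriv.symm
    rw [this]; exact measurable_deriv g
  have hpi : Integrable (gaussianPDFReal 0 1) := integrable_gaussianPDFReal 0 1
  have hxp : Integrable (fun x => x * gaussianPDFReal 0 1 x) := by
    have h : Integrable (fun x : ℝ => x) (gaussianReal 0 1) := by
      exact (memLp_id_gaussianReal (μ := 0) (v := 1) 1).integrable le_rfl
    rw [gaussianReal_of_var_ne_zero _ one_ne_zero,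
      integrable_withDensity_iff (measurable_gaussianPDF 0 1)
        (ae_of_all _ fun _ => gaussianPDF_lt_top)] at h
    simpa [toReal_gaussianPDF] using h
  have key := integral_mul_deriv_eq_deriv_mul_of_integrable (u := g) (v := gaussianPDFReal 0 1)
    (u' := g') (v' := fun x => -x * gaussianPDFReal 0 1 x) (fun x _ => hg x) (fun x _ => hp x)
    ?_ ?_ ?_
  · rw [integral_gaussianReal_eq_integral_smul one_ne_zero,
      integral_gaussianReal_eq_integral_smul one_ne_zero]
    have h1 : ∫ x, gaussianPDFReal 0 1 x • (x * g x)
        = -∫ x, g x * (-x * gaussianPDFReal 0 1 x) := by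
      rw [← integral_neg]
      congr 1; ext x; simp; ring
    rw [h1, key, neg_neg]
    congr 1; ext x; simp [mul_comm]
  · have : Integrable (fun x => g x * (x * gaussianPDFReal 0 1 x)) :=
      hxp.bdd_mul (c := C) hgm.aestronglyMeasurable (ae_of_all _ hC)
    refine this.neg.congr (ae_of_all _ fun x => ?_)
    simp
  · exact hpi.bdd_mul (c := D) hg'm.aestronglyMeasurable (ae_of_all _ hD)
  · exact hpi.bdd_mul (c := C) hgm.aestronglyMeasurable (ae_of_all _ hC)

/-- Resampling one coordinate independently does not change a product measure. With Fubini this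
reduces Stein's identity in several variables to one variable. -/
theorem measurePreserving_update {ι : Type*} [Fintype ι] [DecidableEq ι] (μ : ι → Measure ℝ)
    [∀ i, IsProbabilityMeasure (μ i)] (i : ι) :
    MeasurePreserving (fun p : (ι → ℝ) × ℝ => Function.update p.1 i p.2)
      ((Measure.pi μ).prod (μ i)) (Measure.pi μ) := by
  have hm : Measurable (fun p : (ι → ℝ) × ℝ => Function.update p.1 i p.2) := by
    refine measurable_pi_lambda _ fun j => ?_
    by_cases h : j = i
    · subst h; simpa using measurable_snd
    · simp only [Function.update_of_ne h]; fun_prop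
  refine ⟨hm, (Measure.pi_eq fun s hs => ?_).symm⟩
  rw [Measure.map_apply hm (MeasurableSet.univ_pi hs)]
  have : (fun p : (ι → ℝ) × ℝ => Function.update p.1 i p.2) ⁻¹' Set.univ.pi s
      = (Set.univ.pi (Function.update s i Set.univ)) ×ˢ s i := by
    ext p
    simp only [Set.mem_preimage, Set.mem_univ_pi, Set.mem_prod]
    constructor
    · intro h
      refine ⟨fun j => ?_, by simpa using h i⟩
      by_cases hj : j = i
      · subst hj; simp
      · simpa [Function.update_of_ne hj] using h j
    · rintro ⟨h, h'⟩ j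
      by_cases hj : j = i
      · subst hj; simpa using h'
      · simpa [Function.update_of_ne hj] using h j
  rw [this, Measure.prod_prod, Measure.pi_pi, ← Finset.mul_prod_erase _ _ (Finset.mem_univ i),
    ← Finset.mul_prod_erase (Finset.univ) (fun j => μ j (s j)) (Finset.mem_univ i)]
  simp only [Function.update_self, measure_univ, one_mul]
  rw [mul_comm]
  congr 1
  refine Finset.prod_congr rfl fun j hj => ?_
  rw [Function.update_of_ne (Finset.ne_of_mem_erase hj)]

theorem memLp_eval_stdGaussianPi {ι : Type*} [Fintype ι] (i : ι) (p : NNReal) :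
    MemLp (fun z : ι → ℝ => z i) p (stdGaussianPi ι) :=
  (memLp_id_gaussianReal (μ := 0) (v := 1) p).comp_measurePreserving
    (measurePreserving_eval (fun _ : ι => gaussianReal 0 1) i)

theorem integrable_eval_stdGaussianPi {ι : Type*} [Fintype ι] (i : ι) :
    Integrable (fun z : ι → ℝ => z i) (stdGaussianPi ι) := by
  simpa using (memLp_eval_stdGaussianPi i 1).integrable le_rfl

theorem stein_stdGaussianPi {ι : Type*} [Fintype ι] [DecidableEq ι] (i : ι)
    {G G' : (ι → ℝ) → ℝ} {C D : ℝ}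
    (hG : ∀ z : ι → ℝ, HasDerivAt (fun s => G (Function.update z i s)) (G' z) (z i))
    (hGm : Measurable G) (hG'm : Measurable G') (hC : ∀ z, |G z| ≤ C) (hD : ∀ z, |G' z| ≤ D) :
    ∫ z, z i * G z ∂(stdGaussianPi ι) = ∫ z, G' z ∂(stdGaussianPi ι) := by
  have hmp := measurePreserving_update (fun _ : ι => gaussianReal 0 1) i
  have i1 : Integrable (fun z : ι → ℝ => z i * G z) (stdGaussianPi ι) :=
    (integrable_eval_stdGaussianPi i).mul_bdd (c := C) hGm.aestronglyMeasurable (ae_of_all _ hC)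
  have i2 : Integrable G' (stdGaussianPi ι) :=
    Integrable.of_bound hG'm.aestronglyMeasurable D (ae_of_all _ hD)
  have e : ∀ f : (ι → ℝ) → ℝ, Integrable f (stdGaussianPi ι) →
      ∫ z, f z ∂(stdGaussianPi ι) =
        ∫ z, ∫ s, f (Function.update z i s) ∂(gaussianReal 0 1) ∂(stdGaussianPi ι) := by
    intro f hf
    rw [← integral_prod (fun p : (ι → ℝ) × ℝ => f (Function.update p.1 i p.2))
      (hmp.integrable_comp_of_integrable hf)]
    rw [← integral_map (f := f) hmp.measurable.aemeasurable, hmp.map_eq]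
    rw [hmp.map_eq]; exact hf.aestronglyMeasurable
  rw [e _ i1, e _ i2]
  congr 1; ext z
  simp only [Function.update_self]
  refine stein_gaussianReal (g := fun s => G (Function.update z i s)) (C := C) (D := D)
    (fun s => ?_) (fun _ => hC _) (fun _ => hD _)
  have := hG (Function.update z i s)
  simpa using this

/-- Moving the `i`-th coordinate moves the linear combination along `c i`, so the partial derivative
in Stein's identity is a directional derivative. -/
theorem stein_fderiv {ι E : Type*} [Fintype ι] [NormedAddCommGroup E] [NormedSpace ℝ E]
    {f : E → ℝ} {f' : E → E →L[ℝ] ℝ} (hf : ∀ w, HasFDerivAt f (f' w) w)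
    (c : ι → E) (i : ι) (hc : Continuous fun w => f' w (c i))
    {C D : ℝ} (hC : ∀ w, |f w| ≤ C) (hD : ∀ w, |f' w (c i)| ≤ D) :
    ∫ z, z i * f (∑ j, z j • c j) ∂(stdGaussianPi ι)
      = ∫ z, f' (∑ j, z j • c j) (c i) ∂(stdGaussianPi ι) := by
  classical
  have hf0 : Continuous f := continuous_iff_continuousAt.2 fun w => (hf w).continuousAt
  have hW : Continuous fun z : ι → ℝ => ∑ j, z j • c j := by fun_prop
  refine stein_stdGaussianPi i (G := fun z => f (∑ j, z j • c j))
    (G' := fun z => f' (∑ j, z j • c j) (c i)) (fun z => ?_)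
    (hf0.comp hW).measurable (hc.comp hW).measurable (fun _ => hC _) (fun _ => hD _)
  have hu : ∀ s, ∑ j, Function.update z i s j • c j = ∑ j, z j • c j + (s - z i) • c i := by
    intro s
    rw [← Finset.add_sum_erase _ _ (Finset.mem_univ i),
      ← Finset.add_sum_erase _ (fun j => z j • c j) (Finset.mem_univ i),
      Finset.sum_congr rfl fun j hj => by
        rw [Function.update_of_ne (Finset.ne_of_mem_erase hj)]]
    simp only [Function.update_self]
    module
  simp only [hu]
  have hl : HasDerivAt (fun s => ∑ j, z j • c j + (s - z i) • c i) (c i) (z i) := by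
    simpa using (((hasDerivAt_id (z i)).sub_const (z i)).smul_const (c i)).const_add
      (∑ j, z j • c j)
  refine HasFDerivAt.comp_hasDerivAt (z i) ?_ hl
  simpa using hf (∑ j, z j • c j)

/-! ### Comparison of Gaussian vectors by interpolation. -/

/-- Interpolate by `c θ = sin θ • a + cos θ • b`, with velocity `d θ`. Stein's identity turns the
derivative of the mean of `F` into the mean of `∑ F''(d i, c i)`. The condition `hab` makes the two
processes independent: cross terms vanish, leaving `sin θ cos θ (F''(a,a) - F''(b,b))`, which `hcmp`
makes nonnegative after summation on `[0, π/2]`. -/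
theorem gaussian_comparison {ι E : Type*} [Fintype ι] [NormedAddCommGroup E] [NormedSpace ℝ E]
    {F : E → ℝ} {F' : E → E →L[ℝ] ℝ} {F'' : E → E → E →L[ℝ] ℝ}
    (hF : ∀ w, HasFDerivAt F (F' w) w)
    (hF' : ∀ v w, HasFDerivAt (fun w => F' w v) (F'' w v) w)
    (hc : ∀ u v, Continuous fun w => F'' w v u)
    (b0 : ∃ C, ∀ w, |F w| ≤ C) (b1 : ∀ v, ∃ C, ∀ w, |F' w v| ≤ C)
    (b2 : ∀ u v, ∃ C, ∀ w, |F'' w v u| ≤ C)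
    (a b : ι → E) (hab : ∀ i, a i = 0 ∨ b i = 0)
    (hcmp : ∀ w, ∑ i, F'' w (b i) (b i) ≤ ∑ i, F'' w (a i) (a i)) :
    ∫ z, F (∑ i, z i • b i) ∂(stdGaussianPi ι) ≤ ∫ z, F (∑ i, z i • a i) ∂(stdGaussianPi ι) := by
  obtain ⟨C0, hC0⟩ := b0
  choose C1 hC1 using b1
  choose C2 hC2 using b2
  have hsmul : ∀ (r : ℝ) v w, F'' w (r • v) = r • F'' w v := by
    intro r v w
    refine (hF' (r • v) w).unique ?_
    have h := (hF' v w).const_smul r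
    have e : (fun w => F' w (r • v)) = r • fun w => F' w v := by ext w; simp
    rwa [e]
  have hFc : Continuous F := continuous_iff_continuousAt.2 fun w => (hF w).continuousAt
  have hF'c : ∀ v, Continuous fun w => F' w v := fun v =>
    continuous_iff_continuousAt.2 fun w => (hF' v w).continuousAt
  set c : ℝ → ι → E := fun θ i => Real.sin θ • a i + Real.cos θ • b i with hcdef
  set d : ℝ → ι → E := fun θ i => Real.cos θ • a i - Real.sin θ • b i with hddef
  have hW : ∀ θ, Continuous fun z : ι → ℝ => ∑ j, z j • c θ j := fun θ => by fun_prop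
  have hd1 : ∀ θ i w, |F' w (d θ i)| ≤ C1 (a i) + C1 (b i) := by
    intro θ i w
    simp only [hddef, map_sub, map_smul, smul_eq_mul]
    refine (abs_sub _ _).trans (add_le_add ?_ ?_) <;> rw [abs_mul]
    · exact (mul_le_of_le_one_left (abs_nonneg _) (Real.abs_cos_le_one θ)).trans (hC1 _ _)
    · exact (mul_le_of_le_one_left (abs_nonneg _) (Real.abs_sin_le_one θ)).trans (hC1 _ _)
  have hder : ∀ θ, HasDerivAt (fun θ => ∫ z, F (∑ i, z i • c θ i) ∂(stdGaussianPi ι))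
      (∫ z, ∑ i, z i * F' (∑ j, z j • c θ j) (d θ i) ∂(stdGaussianPi ι)) θ := by
    intro θ
    refine (hasDerivAt_integral_of_dominated_loc_of_deriv_le (s := Set.univ)
      (F := fun θ (z : ι → ℝ) => F (∑ i, z i • c θ i))
      (F' := fun θ (z : ι → ℝ) => ∑ i, z i * F' (∑ j, z j • c θ j) (d θ i))
      (bound := fun z : ι → ℝ => ∑ i, |z i| * (C1 (a i) + C1 (b i))) Filter.univ_mem ?_ ?_ ?_ ?_ ?_ ?_).2
    · exact Eventually.of_forall fun θ => (hFc.comp (hW θ)).aestronglyMeasurable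
    · exact Integrable.of_bound (hFc.comp (hW θ)).aestronglyMeasurable C0
        (ae_of_all _ fun _ => hC0 _)
    · refine Continuous.aestronglyMeasurable (continuous_finsetSum _ fun i _ => ?_)
      exact (continuous_apply i).mul ((hF'c _).comp (hW θ))
    · refine ae_of_all _ fun z θ _ => (Finset.abs_sum_le_sum_abs _ _).trans ?_
      refine Finset.sum_le_sum fun i _ => ?_
      rw [abs_mul]
      exact mul_le_mul_of_nonneg_left (hd1 _ _ _) (abs_nonneg _)
    · exact integrable_finsetSum _ fun i _ => (integrable_eval_stdGaussianPi i).abs.mul_const _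
    · refine ae_of_all _ fun z θ _ => ?_
      have hcθ : HasDerivAt (fun θ => ∑ i, z i • c θ i) (∑ i, z i • d θ i) θ := by
        refine HasDerivAt.fun_sum fun i _ => HasDerivAt.const_smul _ ?_
        have := ((Real.hasDerivAt_sin θ).smul_const (a i)).add
          ((Real.hasDerivAt_cos θ).smul_const (b i))
        exact this.congr_deriv (by simp [hddef, sub_eq_add_neg])
      have := (hF (∑ i, z i • c θ i)).comp_hasDerivAt θ hcθ
      exact this.congr_deriv (by simp)
  have hval : ∀ θ, ∫ z, ∑ i, z i * F' (∑ j, z j • c θ j) (d θ i) ∂(stdGaussianPi ι)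
      = ∫ z, Real.sin θ * Real.cos θ * (∑ i, F'' (∑ j, z j • c θ j) (a i) (a i)
        - ∑ i, F'' (∑ j, z j • c θ j) (b i) (b i)) ∂(stdGaussianPi ι) := by
    intro θ
    have e : ∀ i w, F'' w (d θ i) (c θ i) = Real.sin θ * Real.cos θ *
        (F'' w (a i) (a i) - F'' w (b i) (b i)) := by
      intro i w
      have h0 : ∀ u, F'' w 0 u = 0 := fun u => by simpa using congrArg (· u) (hsmul 0 0 w)
      rcases hab i with h | h
      · simp only [hcdef, hddef, h, smul_zero, zero_add, zero_sub, ← neg_smul, hsmul, map_smul,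
          smul_apply, smul_eq_mul, h0]
        ring
      · simp only [hcdef, hddef, h, smul_zero, add_zero, sub_zero, hsmul, map_smul,
          smul_apply, smul_eq_mul, h0]
        ring
    have hcont : ∀ i, Continuous fun w => F'' w (d θ i) (c θ i) := fun i => hc _ _
    rw [integral_finsetSum]
    · rw [Finset.sum_congr rfl fun i _ => stein_fderiv (hF' (d θ i)) (c θ) i (hcont i)
        (hC1 _) (hC2 _ _), ← integral_finsetSum]
      · congr 1; ext z
        simp only [e]
        rw [← Finset.mul_sum, Finset.sum_sub_distrib]
      · exact fun i _ => Integrable.of_bound ((hcont i).comp (hW θ)).aestronglyMeasurable _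
          (ae_of_all _ fun _ => hC2 _ _ _)
    · exact fun i _ => (integrable_eval_stdGaussianPi i).mul_bdd
        ((hF'c _).comp (hW θ)).aestronglyMeasurable (ae_of_all _ fun _ => hC1 _ _)
  have hmono : MonotoneOn (fun θ => ∫ z, F (∑ i, z i • c θ i) ∂(stdGaussianPi ι))
      (Set.Icc 0 (Real.pi / 2)) := by
    refine monotoneOn_of_deriv_nonneg (convex_Icc _ _)
      (fun θ _ => (hder θ).continuousAt.continuousWithinAt)
      (fun θ _ => (hder θ).differentiableAt.differentiableWithinAt) fun θ hθ => ?_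
    rw [interior_Icc] at hθ
    rw [(hder θ).deriv, hval]
    refine integral_nonneg fun z => mul_nonneg (mul_nonneg ?_ ?_) (sub_nonneg.2 (hcmp _))
    · exact Real.sin_nonneg_of_nonneg_of_le_pi hθ.1.le (by linarith [hθ.2, Real.pi_pos])
    · exact Real.cos_nonneg_of_neg_pi_div_two_le_of_le (by linarith [hθ.1, Real.pi_pos]) hθ.2.le
  have h := hmono (Set.left_mem_Icc.2 (by positivity)) (Set.right_mem_Icc.2 (by positivity))
    (by positivity)
  simpa [hcdef] using h

/-- The second derivative of `∏ φ (w x)` has diagonal terms with `φ''`, of no definite sign, hence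
the equality in `hdiag`. The off-diagonal terms are products `φ' φ'` with nonnegative weights, so an
inequality suffices there. -/
theorem gaussian_comparison_prod {ι X K : Type*} [Fintype ι] [Fintype X]
    [NormedAddCommGroup K] [NormedSpace ℝ K]
    {φ : K → ℝ} {φ' : K → K →L[ℝ] ℝ} {φ'' : K → K → K →L[ℝ] ℝ}
    (hφ : ∀ w, HasFDerivAt φ (φ' w) w)
    (hφ' : ∀ v w, HasFDerivAt (fun w => φ' w v) (φ'' w v) w)
    (hc : ∀ u v, Continuous fun w => φ'' w v u)
    (h0 : ∀ w, 0 ≤ φ w) (h1 : ∀ w, φ w ≤ 1) (b1 : ∀ v, ∃ C, ∀ w, |φ' w v| ≤ C)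
    (b2 : ∀ u v, ∃ C, ∀ w, |φ'' w v u| ≤ C)
    (a b : ι → X → K) (hab : ∀ i, a i = 0 ∨ b i = 0)
    (hdiag : ∀ x w, ∑ i, φ'' w (b i x) (b i x) = ∑ i, φ'' w (a i x) (a i x))
    (hoff : ∀ x y w w', ∑ i, φ' w (b i x) * φ' w' (b i y) ≤ ∑ i, φ' w (a i x) * φ' w' (a i y)) :
    ∫ z, ∏ x, φ (∑ i, z i • b i x) ∂(stdGaussianPi ι)
      ≤ ∫ z, ∏ x, φ (∑ i, z i • a i x) ∂(stdGaussianPi ι) := by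
  classical
  have hφc : Continuous φ := continuous_iff_continuousAt.2 fun w => (hφ w).continuousAt
  have hφ'c : ∀ v, Continuous fun w => φ' w v := fun v =>
    continuous_iff_continuousAt.2 fun w => (hφ' v w).continuousAt
  choose C1 hC1 using b1
  choose C2 hC2 using b2
  have hC1' : ∀ v, 0 ≤ C1 v := fun v => (abs_nonneg _).trans (hC1 v 0)
  have p0 : ∀ (s : Finset X) (w : X → K), 0 ≤ ∏ y ∈ s, φ (w y) := fun s w =>
    Finset.prod_nonneg fun y _ => h0 _
  have p1 : ∀ (s : Finset X) (w : X → K), |∏ y ∈ s, φ (w y)| ≤ 1 := fun s w => by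
    rw [abs_of_nonneg (p0 s w)]
    exact Finset.prod_le_one (fun y _ => h0 _) (fun y _ => h1 _)
  have pm : ∀ (s : Finset X) (w : X → K) (r C : ℝ), |r| ≤ C → |(∏ y ∈ s, φ (w y)) * r| ≤ C := by
    intro s w r C h
    rw [abs_mul]
    exact (mul_le_of_le_one_left (abs_nonneg _) (p1 s w)).trans h
  have hcomp : ∀ (x : X) (w : X → K), HasFDerivAt (fun w : X → K => φ (w x))
      ((φ' (w x)).comp (ContinuousLinearMap.proj x)) w := fun x w =>
    (hφ (w x)).comp w (hasFDerivAt_apply x w)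
  have hcomp' : ∀ (x : X) (u : K) (w : X → K), HasFDerivAt (fun w : X → K => φ' (w x) u)
      ((φ'' (w x) u).comp (ContinuousLinearMap.proj x)) w := fun x u w =>
    HasFDerivAt.comp (g := fun k => φ' k u) (f := fun w : X → K => w x) w (hφ' u (w x))
      (hasFDerivAt_apply x w)
  have hprod : ∀ (s : Finset X) (w : X → K), HasFDerivAt (fun w : X → K => ∏ y ∈ s, φ (w y))
      (∑ y ∈ s, (∏ z ∈ s.erase y, φ (w z)) •
        (φ' (w y)).comp (ContinuousLinearMap.proj y)) w := fun s w =>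
    HasFDerivAt.finsetProd fun x _ => hcomp x w
  have key := gaussian_comparison (ι := ι) (E := X → K) (F := fun w => ∏ x, φ (w x))
    (F' := fun w => ∑ x, (∏ y ∈ Finset.univ.erase x, φ (w y)) •
      (φ' (w x)).comp (ContinuousLinearMap.proj x))
    (F'' := fun w v => ∑ x, ((∏ y ∈ Finset.univ.erase x, φ (w y)) •
      (φ'' (w x) (v x)).comp (ContinuousLinearMap.proj x) +
      φ' (w x) (v x) • ∑ y ∈ Finset.univ.erase x, (∏ z ∈ (Finset.univ.erase x).erase y, φ (w z)) •
        (φ' (w y)).comp (ContinuousLinearMap.proj y)))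
    (fun w => hprod _ w) ?_ ?_ ?_ ?_ ?_ a b hab ?_
  · simpa only [Finset.sum_apply, Pi.smul_apply] using key
  · intro v w
    have h : ∀ x ∈ Finset.univ, HasFDerivAt
        (fun w : X → K => (∏ y ∈ Finset.univ.erase x, φ (w y)) * φ' (w x) (v x)) _ w :=
      fun x _ => (hprod _ w).mul (hcomp' x (v x) w)
    refine ((HasFDerivAt.fun_sum h).congr_of_eventuallyEq
      (Eventually.of_forall fun w => ?_)).congr_fderiv ?_
    · simp
    · rfl
  · intro u v
    simp only [sum_apply, add_apply, smul_apply,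
      ContinuousLinearMap.comp_apply, ContinuousLinearMap.proj_apply, smul_eq_mul]
    refine continuous_finsetSum _ fun x _ => Continuous.add ?_ ?_
    · refine Continuous.mul (by fun_prop) ?_
      exact (hc (u x) (v x)).comp (continuous_apply x)
    · refine Continuous.mul ((hφ'c _).comp (continuous_apply x))
        (continuous_finsetSum _ fun y _ => Continuous.mul (by fun_prop) ?_)
      exact (hφ'c _).comp (continuous_apply y)
  · exact ⟨1, fun w => p1 _ w⟩
  · intro v
    refine ⟨∑ x, C1 (v x), fun w => ?_⟩
    simp only [sum_apply, smul_apply,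
      ContinuousLinearMap.comp_apply, ContinuousLinearMap.proj_apply, smul_eq_mul]
    exact (Finset.abs_sum_le_sum_abs _ _).trans
      (Finset.sum_le_sum fun x _ => pm _ _ _ _ (hC1 _ _))
  · intro u v
    refine ⟨∑ x, (C2 (u x) (v x) + C1 (v x) * ∑ y ∈ Finset.univ.erase x, C1 (u y)), fun w => ?_⟩
    simp only [sum_apply, add_apply, smul_apply,
      ContinuousLinearMap.comp_apply, ContinuousLinearMap.proj_apply, smul_eq_mul]
    refine (Finset.abs_sum_le_sum_abs _ _).trans (Finset.sum_le_sum fun x _ => ?_)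
    refine (abs_add_le _ _).trans (add_le_add (pm _ _ _ _ (hC2 _ _ _)) ?_)
    rw [abs_mul]
    exact mul_le_mul (hC1 _ _) ((Finset.abs_sum_le_sum_abs _ _).trans
      (Finset.sum_le_sum fun y _ => pm _ _ _ _ (hC1 _ _))) (abs_nonneg _) (hC1' _)
  · intro w
    simp only [sum_apply, add_apply, smul_apply,
      ContinuousLinearMap.comp_apply, ContinuousLinearMap.proj_apply, smul_eq_mul,
      Finset.sum_add_distrib]
    refine add_le_add (le_of_eq ?_) ?_
    · rw [Finset.sum_comm, Finset.sum_comm (s := Finset.univ (α := ι))]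
      refine Finset.sum_congr rfl fun x _ => ?_
      rw [← Finset.mul_sum, hdiag, Finset.mul_sum]
    · simp only [Finset.mul_sum]
      rw [Finset.sum_comm, Finset.sum_comm (s := Finset.univ (α := ι))]
      refine Finset.sum_le_sum fun x _ => ?_
      rw [Finset.sum_comm, Finset.sum_comm (s := Finset.univ (α := ι))]
      refine Finset.sum_le_sum fun y _ => ?_
      simp only [mul_left_comm _ (∏ z ∈ (Finset.univ.erase x).erase y, φ (w z)),
        ← Finset.mul_sum]
      exact mul_le_mul_of_nonneg_left (hoff _ _ _ _) (p0 _ _)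

/-! ### A norm smoothed at the origin, with bounds on its derivatives. -/

open scoped RealInnerProductSpace

section SmoothNorm

variable {V : Type*} [NormedAddCommGroup V]

/-- A smooth approximation of the norm. -/
noncomputable def smoothNorm (δ : ℝ) (v : V) : ℝ := √(‖v‖ ^ 2 + δ ^ 2)

theorem smoothNorm_ge (δ : ℝ) (v : V) : δ ≤ smoothNorm δ v :=
  Real.le_sqrt_of_sq_le (by nlinarith [sq_nonneg ‖v‖])

theorem smoothNorm_pos {δ : ℝ} (hδ : 0 < δ) (v : V) : 0 < smoothNorm δ v :=
  hδ.trans_le (smoothNorm_ge δ v)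

theorem norm_le_smoothNorm (δ : ℝ) (v : V) : ‖v‖ ≤ smoothNorm δ v :=
  Real.le_sqrt_of_sq_le (by nlinarith [sq_nonneg δ])

theorem smoothNorm_le {δ : ℝ} (hδ : 0 ≤ δ) (v : V) : smoothNorm δ v ≤ ‖v‖ + δ :=
  Real.sqrt_le_iff.2 ⟨by positivity, by nlinarith [mul_nonneg (norm_nonneg v) hδ]⟩

theorem continuous_smoothNorm (δ : ℝ) : Continuous (smoothNorm δ : V → ℝ) := by
  unfold smoothNorm; fun_prop

variable [InnerProductSpace ℝ V]

theorem hasFDerivAt_smoothNorm {δ : ℝ} (hδ : 0 < δ) (v : V) :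
    HasFDerivAt (smoothNorm δ) ((smoothNorm δ v)⁻¹ • innerSL ℝ v) v := by
  have hne : ‖v‖ ^ 2 + δ ^ 2 ≠ 0 := by positivity
  have h := ((hasStrictFDerivAt_norm_sq v).hasFDerivAt.add_const (δ ^ 2)).sqrt hne
  refine h.congr_fderiv ?_
  ext u
  simp [smoothNorm]
  field_simp

/-- The derivative of `w ↦ smoothNorm δ w.1 + w.2`. -/
noncomputable def shiftD (δ : ℝ) (w : V × ℝ) : V × ℝ →L[ℝ] ℝ :=
  (smoothNorm δ w.1)⁻¹ • (innerSL ℝ w.1).comp (ContinuousLinearMap.fst ℝ V ℝ) +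
    ContinuousLinearMap.snd ℝ V ℝ

/-- The derivative of `w ↦ shiftD δ w v`. -/
noncomputable def shiftDD (δ : ℝ) (w v : V × ℝ) : V × ℝ →L[ℝ] ℝ :=
  (smoothNorm δ w.1)⁻¹ • (innerSL ℝ v.1).comp (ContinuousLinearMap.fst ℝ V ℝ) -
    (⟪w.1, v.1⟫ * ((smoothNorm δ w.1) ^ 2)⁻¹ * (smoothNorm δ w.1)⁻¹) •
      (innerSL ℝ w.1).comp (ContinuousLinearMap.fst ℝ V ℝ)

theorem shiftD_apply (δ : ℝ) (w v : V × ℝ) :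
    shiftD δ w v = (smoothNorm δ w.1)⁻¹ * ⟪w.1, v.1⟫ + v.2 := by
  simp [shiftD]

theorem shiftDD_apply (δ : ℝ) (w v u : V × ℝ) :
    shiftDD δ w v u = (smoothNorm δ w.1)⁻¹ * ⟪v.1, u.1⟫ -
      ⟪w.1, v.1⟫ * ((smoothNorm δ w.1) ^ 2)⁻¹ * (smoothNorm δ w.1)⁻¹ * ⟪w.1, u.1⟫ := by
  simp [shiftDD]

theorem hasFDerivAt_shift {δ : ℝ} (hδ : 0 < δ) (w : V × ℝ) :
    HasFDerivAt (fun w : V × ℝ => smoothNorm δ w.1 + w.2) (shiftD δ w) w := by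
  have h := ((hasFDerivAt_smoothNorm hδ w.1).comp w hasFDerivAt_fst).add
    (hasFDerivAt_snd (𝕜 := ℝ) (p := w))
  exact h

theorem hasFDerivAt_shiftD {δ : ℝ} (hδ : 0 < δ) (w v : V × ℝ) :
    HasFDerivAt (fun w : V × ℝ => shiftD δ w v) (shiftDD δ w v) w := by
  simp only [shiftD_apply]
  have hN : HasFDerivAt (fun w : V × ℝ => smoothNorm δ w.1)
      (((smoothNorm δ w.1)⁻¹ • innerSL ℝ w.1).comp (ContinuousLinearMap.fst ℝ V ℝ)) w :=
    (hasFDerivAt_smoothNorm hδ w.1).comp w hasFDerivAt_fst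
  have hI : HasFDerivAt (fun w : V × ℝ => ⟪w.1, v.1⟫)
      ((innerSL ℝ v.1).comp (ContinuousLinearMap.fst ℝ V ℝ)) w := by
    have := ((innerSL ℝ v.1).comp (ContinuousLinearMap.fst ℝ V ℝ)).hasFDerivAt (x := w)
    refine this.congr_of_eventuallyEq (Eventually.of_forall fun u => ?_)
    simp [real_inner_comm]
  have hinv := (hasDerivAt_inv (smoothNorm_pos hδ w.1).ne').comp_hasFDerivAt w hN
  refine ((hinv.mul hI).add_const v.2).congr_fderiv ?_
  ext u <;> simp [shiftDD]; ring

theorem abs_inv_smoothNorm_mul_inner_le {δ : ℝ} (hδ : 0 < δ) (w v : V) :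
    |(smoothNorm δ w)⁻¹ * ⟪w, v⟫| ≤ ‖v‖ := by
  have hN := smoothNorm_pos hδ w
  rw [abs_mul, abs_of_pos (inv_pos.2 hN), inv_mul_le_iff₀ hN]
  exact (abs_real_inner_le_norm _ _).trans
    (mul_le_mul_of_nonneg_right (norm_le_smoothNorm _ _) (norm_nonneg _))

theorem abs_shiftD_le {δ : ℝ} (hδ : 0 < δ) (w v : V × ℝ) :
    |shiftD δ w v| ≤ ‖v.1‖ + |v.2| := by
  rw [shiftD_apply]
  exact (abs_add_le _ _).trans (add_le_add_left (abs_inv_smoothNorm_mul_inner_le hδ _ _) _)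

theorem abs_shiftDD_le {δ : ℝ} (hδ : 0 < δ) (w v u : V × ℝ) :
    |shiftDD δ w v u| ≤ δ⁻¹ * (‖v.1‖ * ‖u.1‖) + δ⁻¹ * (‖v.1‖ * ‖u.1‖) := by
  have hN := smoothNorm_pos hδ w.1
  have hi : (smoothNorm δ w.1)⁻¹ ≤ δ⁻¹ := inv_anti₀ hδ (smoothNorm_ge δ _)
  -- Each inner product with `w` is paired with one inverse norm, so each pair is bounded uniformly
  -- in `w`; one factor at most `δ⁻¹` remains.
  have e : shiftDD δ w v u = (smoothNorm δ w.1)⁻¹ * ⟪v.1, u.1⟫ -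
      (smoothNorm δ w.1)⁻¹ * (((smoothNorm δ w.1)⁻¹ * ⟪w.1, v.1⟫) *
        ((smoothNorm δ w.1)⁻¹ * ⟪w.1, u.1⟫)) := by
    rw [shiftDD_apply]; ring
  rw [e]
  refine (abs_sub _ _).trans (add_le_add ?_ ?_) <;> rw [abs_mul, abs_of_pos (inv_pos.2 hN)]
  · exact mul_le_mul hi (abs_real_inner_le_norm _ _) (abs_nonneg _) (inv_pos.2 hδ).le
  · refine mul_le_mul hi ?_ (abs_nonneg _) (inv_pos.2 hδ).le
    rw [abs_mul]
    exact mul_le_mul (abs_inv_smoothNorm_mul_inner_le hδ _ _)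
      (abs_inv_smoothNorm_mul_inner_le hδ _ _) (abs_nonneg _) (norm_nonneg _)

end SmoothNorm

/-! ### Gordon's inequality for smooth test functions. -/

/-- The vectors defining the process `x ↦ (H x, γ)`. -/
noncomputable def bilinearVec {m n : ℕ} {X : Type*} (x : X → Fin n → ℝ) :
    (Fin m × Fin n ⊕ Unit) ⊕ (Fin m ⊕ Fin n) → X → EuclideanSpace ℝ (Fin m) × ℝ
  | .inl (.inl p) => fun k => (x k p.2 • EuclideanSpace.single p.1 1, 0)
  | .inl (.inr _) => fun _ => (0, 1)
  | .inr _ => 0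

/-- The vectors defining the process `x ↦ (g, h · x)`. -/
noncomputable def decoupledVec {m n : ℕ} {X : Type*} (x : X → Fin n → ℝ) :
    (Fin m × Fin n ⊕ Unit) ⊕ (Fin m ⊕ Fin n) → X → EuclideanSpace ℝ (Fin m) × ℝ
  | .inl _ => 0
  | .inr (.inl i) => fun _ => (EuclideanSpace.single i 1, 0)
  | .inr (.inr j) => fun k => (0, x k j)

/-- The comparison is applied to `φ w = ψ (smoothNorm δ w.1 + w.2)`. Diagonal terms agree because
the `x k` are unit vectors. Off the diagonal, with `p, q` the values of `ψ'`, the claim is `p q (S +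
c) ≤ p q (S c + 1)`; the scalar `γ` contributes the `1`. -/
theorem gordon_smooth {m n : ℕ} {X : Type*} [Fintype X] (x : X → Fin n → ℝ)
    (hx : ∀ k, ∑ j, x k j ^ 2 = 1) {ψ ψ' ψ'' : ℝ → ℝ} {C D δ : ℝ} (hδ : 0 < δ)
    (hψ : ∀ s, HasDerivAt ψ (ψ' s) s) (hψ' : ∀ s, HasDerivAt ψ' (ψ'' s) s)
    (hc : Continuous ψ'') (h0 : ∀ s, 0 ≤ ψ s) (h1 : ∀ s, ψ s ≤ 1) (h0' : ∀ s, 0 ≤ ψ' s)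
    (hC : ∀ s, |ψ' s| ≤ C) (hD : ∀ s, |ψ'' s| ≤ D) :
    ∫ z, ∏ k, ψ (smoothNorm δ (∑ i, z i • decoupledVec (m := m) x i k).1 +
        (∑ i, z i • decoupledVec (m := m) x i k).2)
      ∂(stdGaussianPi ((Fin m × Fin n ⊕ Unit) ⊕ (Fin m ⊕ Fin n)))
    ≤ ∫ z, ∏ k, ψ (smoothNorm δ (∑ i, z i • bilinearVec (m := m) x i k).1 +
        (∑ i, z i • bilinearVec (m := m) x i k).2)
      ∂(stdGaussianPi ((Fin m × Fin n ⊕ Unit) ⊕ (Fin m ⊕ Fin n))) := by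
  have hC0 : 0 ≤ C := (abs_nonneg _).trans (hC 0)
  have hD0 : 0 ≤ D := (abs_nonneg _).trans (hD 0)
  have hψ'c : Continuous ψ' := continuous_iff_continuousAt.2 fun w => (hψ' w).continuousAt
  have hT : Continuous fun w : EuclideanSpace ℝ (Fin m) × ℝ => smoothNorm δ w.1 + w.2 :=
    ((continuous_smoothNorm δ).comp continuous_fst).add continuous_snd
  have hN : Continuous fun w : EuclideanSpace ℝ (Fin m) × ℝ => (smoothNorm δ w.1)⁻¹ :=
    ((continuous_smoothNorm δ).comp continuous_fst).inv₀ fun w => (smoothNorm_pos hδ _).ne'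
  have hN2 : Continuous fun w : EuclideanSpace ℝ (Fin m) × ℝ => ((smoothNorm δ w.1) ^ 2)⁻¹ :=
    (((continuous_smoothNorm δ).comp continuous_fst).pow 2).inv₀
      fun w => (pow_pos (smoothNorm_pos hδ _) 2).ne'
  refine gaussian_comparison_prod
    (φ := fun w : EuclideanSpace ℝ (Fin m) × ℝ => ψ (smoothNorm δ w.1 + w.2))
    (φ' := fun w => ψ' (smoothNorm δ w.1 + w.2) • shiftD δ w)
    (φ'' := fun w v => ψ' (smoothNorm δ w.1 + w.2) • shiftDD δ w v +
      shiftD δ w v • ψ'' (smoothNorm δ w.1 + w.2) • shiftD δ w)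
    ?_ ?_ ?_ (fun _ => h0 _) (fun _ => h1 _) ?_ ?_ (bilinearVec x) (decoupledVec x) ?_ ?_ ?_
  · exact fun w => (hψ _).comp_hasFDerivAt w (hasFDerivAt_shift hδ w)
  · intro v w
    exact ((hψ' _).comp_hasFDerivAt w (hasFDerivAt_shift hδ w)).mul (hasFDerivAt_shiftD hδ w v)
  · intro u v
    simp only [add_apply, smul_apply, smul_eq_mul, shiftD_apply, shiftDD_apply]
    have h1 := hψ'c.comp hT
    have h2 := hc.comp hT
    simp only [Function.comp_def] at h1 h2
    fun_prop
  · intro v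
    refine ⟨C * (‖v.1‖ + |v.2|), fun w => ?_⟩
    rw [smul_apply, smul_eq_mul, abs_mul]
    exact mul_le_mul (hC _) (abs_shiftD_le hδ _ _) (abs_nonneg _) hC0
  · intro u v
    refine ⟨C * (δ⁻¹ * (‖v.1‖ * ‖u.1‖) + δ⁻¹ * (‖v.1‖ * ‖u.1‖)) +
      (‖v.1‖ + |v.2|) * (D * (‖u.1‖ + |u.2|)), fun w => ?_⟩
    simp only [add_apply, smul_apply, smul_eq_mul]
    refine (abs_add_le _ _).trans (add_le_add ?_ ?_)
    · rw [abs_mul]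
      exact mul_le_mul (hC _) (abs_shiftDD_le hδ _ _ _) (abs_nonneg _) hC0
    · rw [abs_mul, abs_mul]
      exact mul_le_mul (abs_shiftD_le hδ _ _) (mul_le_mul (hD _) (abs_shiftD_le hδ _ _)
        (abs_nonneg _) hD0) (by positivity) (by positivity)
  · rintro ((_ | _) | _) <;> simp [bilinearVec, decoupledVec]
  · intro k w
    simp only [Fintype.sum_sum_type, Fintype.sum_prod_type, bilinearVec, decoupledVec, add_apply,
      smul_apply, smul_eq_mul, shiftD_apply, shiftDD_apply, Pi.zero_apply, Prod.fst_zero,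
      Prod.snd_zero, inner_zero_right, inner_smul_right, inner_smul_left,
      EuclideanSpace.inner_single_right, Finset.univ_unique, Finset.sum_singleton]
    simp
    congr 1
    · refine Finset.sum_congr rfl fun i _ => ?_
      -- The factor `1` is replaced by `∑ j, x k j ^ 2`, which produces the double sum over matrix
      -- entries.
      conv_lhs => rw [← mul_one (_ + _), ← hx k, Finset.mul_sum]
      exact Finset.sum_congr rfl fun j _ => by ring
    · conv_rhs => rw [← mul_one (ψ'' _), ← hx k, Finset.mul_sum]
      exact Finset.sum_congr rfl fun j _ => by ring
  · intro k l w w'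
    simp only [Fintype.sum_sum_type, Fintype.sum_prod_type, bilinearVec, decoupledVec,
      smul_apply, smul_eq_mul, shiftD_apply, Pi.zero_apply, Prod.fst_zero,
      Prod.snd_zero, inner_zero_right, inner_smul_right,
      EuclideanSpace.inner_single_right, Finset.univ_unique, Finset.sum_singleton]
    simp
    set p := ψ' (smoothNorm δ w.1 + w.2)
    set q := ψ' (smoothNorm δ w'.1 + w'.2)
    set c := ∑ j, x k j * x l j with hcdef
    set S := (smoothNorm δ w.1)⁻¹ * (smoothNorm δ w'.1)⁻¹ * ⟪w.1, w'.1⟫ with hS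
    have hpq : 0 ≤ p * q := mul_nonneg (h0' _) (h0' _)
    have hc1 : c ≤ 1 := by
      have : 2 * c ≤ ∑ j, (x k j ^ 2 + x l j ^ 2) := by
        rw [hcdef, Finset.mul_sum]
        exact Finset.sum_le_sum fun j _ => by nlinarith [sq_nonneg (x k j - x l j)]
      rw [Finset.sum_add_distrib, hx, hx] at this
      linarith
    have hS1 : S ≤ 1 := by
      have e1 := smoothNorm_pos hδ w.1
      have e2 := smoothNorm_pos hδ w'.1
      rw [hS, ← mul_inv, inv_mul_le_iff₀ (mul_pos e1 e2), mul_one]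
      exact (real_inner_le_norm _ _).trans (mul_le_mul (norm_le_smoothNorm _ _)
        (norm_le_smoothNorm _ _) (norm_nonneg _) e1.le)
    have hin : ⟪w.1, w'.1⟫ = ∑ i, w.1 i * w'.1 i := by
      simp [PiLp.inner_apply, mul_comm]
    have t1 : ∑ i, p * ((smoothNorm δ w.1)⁻¹ * w.1 i) * (q * ((smoothNorm δ w'.1)⁻¹ * w'.1 i))
        = p * q * S := by
      rw [hS, hin, Finset.mul_sum, Finset.mul_sum]
      exact Finset.sum_congr rfl fun j _ => by ring
    have t2 : ∑ j, p * x k j * (q * x l j) = p * q * c := by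
      rw [hcdef, Finset.mul_sum]
      exact Finset.sum_congr rfl fun j _ => by ring
    have t3 : ∑ i, ∑ j, p * ((smoothNorm δ w.1)⁻¹ * (x k j * w.1 i)) *
        (q * ((smoothNorm δ w'.1)⁻¹ * (x l j * w'.1 i))) = p * q * S * c := by
      rw [← t1, Finset.sum_mul]
      refine Finset.sum_congr rfl fun i _ => ?_
      rw [hcdef, Finset.mul_sum]
      exact Finset.sum_congr rfl fun j _ => by ring
    rw [t1, t2, t3]
    -- The difference of the two sides is `p q (1 - c)(1 - S)`.
    nlinarith [mul_nonneg hpq (mul_nonneg (sub_nonneg.2 hc1) (sub_nonneg.2 hS1))]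

theorem sum_smul_decoupledVec {m n : ℕ} {X : Type*} (x : X → Fin n → ℝ)
    (z : (Fin m × Fin n ⊕ Unit) ⊕ (Fin m ⊕ Fin n) → ℝ) (k : X) :
    ∑ i, z i • decoupledVec (m := m) x i k =
      (WithLp.toLp 2 fun i => z (.inr (.inl i)), ∑ j, z (.inr (.inr j)) * x k j) := by
  simp only [Fintype.sum_sum_type, decoupledVec, Pi.zero_apply, smul_zero, Finset.sum_const_zero,
    zero_add]
  refine Prod.ext ?_ ?_
  · ext i
    simp [Prod.fst_sum, Pi.single_apply]
  · simp [Prod.snd_sum]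

theorem sum_smul_bilinearVec {m n : ℕ} {X : Type*} (x : X → Fin n → ℝ)
    (z : (Fin m × Fin n ⊕ Unit) ⊕ (Fin m ⊕ Fin n) → ℝ) (k : X) :
    ∑ i, z i • bilinearVec (m := m) x i k =
      (WithLp.toLp 2 ((Matrix.of fun i j => z (.inl (.inl (i, j)))).mulVec (x k)),
        z (.inl (.inr ()))) := by
  simp only [Fintype.sum_sum_type, bilinearVec, Pi.zero_apply, smul_zero, Finset.sum_const_zero,
    add_zero]
  refine Prod.ext ?_ ?_
  · ext i
    simp [Prod.fst_sum, Pi.single_apply, Matrix.mulVec, dotProduct, Fintype.sum_prod_type]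
  · simp [Prod.snd_sum]

/-! ### From smooth test functions to tail events. -/

theorem exists_bound_of_eq_zero_off_Icc {f : ℝ → ℝ} (hf : Continuous f)
    (h0 : ∀ x ∉ Set.Icc (0 : ℝ) 1, f x = 0) : ∃ C, ∀ x, |f x| ≤ C := by
  obtain ⟨C, hC⟩ := isCompact_Icc.exists_bound_of_continuousOn (s := Set.Icc (0 : ℝ) 1)
    hf.continuousOn
  refine ⟨C, fun x => ?_⟩
  by_cases hx : x ∈ Set.Icc (0 : ℝ) 1
  · exact hC x hx
  · rw [h0 x hx, abs_zero]
    exact (norm_nonneg _).trans (hC 0 (by simp))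

/-- Both derivatives of the smooth transition are continuous and vanish off `[0, 1]`, hence are
bounded. -/
theorem exists_smooth_step : ∃ f f' f'' : ℝ → ℝ, ∃ C D : ℝ,
    (∀ s, HasDerivAt f (f' s) s) ∧ (∀ s, HasDerivAt f' (f'' s) s) ∧ Continuous f'' ∧
    (∀ s, 0 ≤ f s) ∧ (∀ s, f s ≤ 1) ∧ (∀ s, 0 ≤ f' s) ∧ (∀ s, |f' s| ≤ C) ∧ (∀ s, |f'' s| ≤ D) ∧
    (∀ s ≤ 0, f s = 0) ∧ (∀ s, 1 ≤ s → f s = 1) := by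
  have h2 : ContDiff ℝ 2 Real.smoothTransition := Real.smoothTransition.contDiff (n := 2)
  have h1 : ContDiff ℝ 1 (deriv Real.smoothTransition) := by
    have := (contDiff_succ_iff_deriv (n := 1)).1 (by simpa [one_add_one_eq_two] using h2)
    exact this.2.2
  have hc2 : Continuous (deriv (deriv Real.smoothTransition)) := h1.continuous_deriv le_rfl
  have z0 : ∀ x ∉ Set.Icc (0 : ℝ) 1, deriv Real.smoothTransition =ᶠ[𝓝 x] fun _ => 0 := by
    have key : ∀ x ∉ Set.Icc (0 : ℝ) 1, deriv Real.smoothTransition x = 0 := by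
      intro x hx
      rcases lt_or_ge x 0 with h | h
      · have : Real.smoothTransition =ᶠ[𝓝 x] fun _ => 0 := by
          filter_upwards [Iio_mem_nhds h] with y hy
          exact Real.smoothTransition.zero_of_nonpos (le_of_lt hy)
        rw [this.deriv_eq, deriv_const]
      · have h' : 1 < x := by
          by_contra h'
          exact hx ⟨h, not_lt.1 h'⟩
        have : Real.smoothTransition =ᶠ[𝓝 x] fun _ => 1 := by
          filter_upwards [Ioi_mem_nhds h'] with y hy
          exact Real.smoothTransition.one_of_one_le (le_of_lt hy)
        rw [this.deriv_eq, deriv_const]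
    intro x hx
    filter_upwards [isClosed_Icc.isOpen_compl.mem_nhds hx] with y hy using key y hy
  obtain ⟨C, hC⟩ := exists_bound_of_eq_zero_off_Icc h1.continuous fun x hx => (z0 x hx).eq_of_nhds
  obtain ⟨D, hD⟩ := exists_bound_of_eq_zero_off_Icc hc2 fun x hx => by
    rw [(z0 x hx).deriv_eq, deriv_const]
  exact ⟨Real.smoothTransition, deriv Real.smoothTransition, deriv (deriv Real.smoothTransition),
    C, D, fun s => (h2.differentiable (by norm_num) s).hasDerivAt,
    fun s => (h1.differentiable (by norm_num) s).hasDerivAt, hc2,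
    Real.smoothTransition.nonneg, Real.smoothTransition.le_one,
    fun s => Real.smoothTransition.monotone.deriv_nonneg, hC, hD,
    fun s hs => Real.smoothTransition.zero_of_nonpos hs,
    fun s hs => Real.smoothTransition.one_of_one_le hs⟩

/-- The step is sharpened at rate `p + 1` while the norm is smoothed at scale `1/(p + 1)`. Smoothing
raises the argument of `f` by at most `1`, and the shift `- 1` absorbs this. The products thus
converge pointwise to the indicator of the strict event, boundary included. -/
theorem tendsto_integral_prod_step {Ω X V : Type*} [MeasurableSpace Ω] [Fintype X]
    [NormedAddCommGroup V] [MeasurableSpace V] [BorelSpace V]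
    {P : Measure Ω} [IsProbabilityMeasure P] {f : ℝ → ℝ} (hf : Continuous f) (h0 : ∀ s, 0 ≤ f s)
    (h1 : ∀ s, f s ≤ 1) (hz : ∀ s ≤ 0, f s = 0) (ho : ∀ s, 1 ≤ s → f s = 1)
    {v : X → Ω → V} {r : X → Ω → ℝ} (hv : ∀ k, Measurable (v k)) (hr : ∀ k, Measurable (r k))
    (t : ℝ) :
    Tendsto (fun p : ℕ => ∫ ω, ∏ k, f (((p : ℝ) + 1) *
        (smoothNorm ((p : ℝ) + 1)⁻¹ (v k ω) + r k ω - t) - 1) ∂P) atTop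
      (𝓝 (P.real {ω | ∀ k, t < ‖v k ω‖ + r k ω})) := by
  have hms : MeasurableSet {ω | ∀ k, t < ‖v k ω‖ + r k ω} := by
    rw [Set.ofPred_forall]
    exact MeasurableSet.iInter fun k =>
      measurableSet_lt measurable_const ((hv k).norm.add (hr k))
  rw [← integral_indicator_one hms]
  refine tendsto_integral_of_dominated_convergence (fun _ => 1) (fun p => ?_)
    (integrable_const _) (fun p => ae_of_all _ fun ω => ?_) (ae_of_all _ fun ω => ?_)
  · refine (Finset.measurable_fun_prod _ fun k _ => hf.measurable.comp ?_).aestronglyMeasurable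
    have := (continuous_smoothNorm (V := V) ((p : ℝ) + 1)⁻¹).measurable.comp (hv k)
    exact (((this.add (hr k)).sub_const t).const_mul _).sub_const 1
  · rw [Real.norm_of_nonneg (Finset.prod_nonneg fun _ _ => h0 _)]
    exact Finset.prod_le_one (fun _ _ => h0 _) fun _ _ => h1 _
  · by_cases hω : ∀ k, t < ‖v k ω‖ + r k ω
    · rw [Set.indicator_of_mem (by exact hω)]
      refine tendsto_const_nhds.congr' ?_
      -- The threshold `2` leaves `1` after the shift, where the step has reached its final value.
      have : ∀ᶠ p : ℕ in atTop, ∀ k, 2 ≤ ((p : ℝ) + 1) * (‖v k ω‖ + r k ω - t) := by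
        refine eventually_all.2 fun k => ?_
        have h := Tendsto.atTop_mul_const (sub_pos.2 (hω k))
          (tendsto_atTop_add_const_right atTop (1 : ℝ) (tendsto_natCast_atTop_atTop (R := ℝ)))
        exact h.eventually_ge_atTop 2
      filter_upwards [this] with p hp
      symm
      refine Finset.prod_eq_one fun k _ => ho _ ?_
      have h2 : ((p : ℝ) + 1) * (‖v k ω‖ + r k ω - t) ≤ ((p : ℝ) + 1) *
          (smoothNorm ((p : ℝ) + 1)⁻¹ (v k ω) + r k ω - t) :=
        mul_le_mul_of_nonneg_left (by linarith [norm_le_smoothNorm ((p : ℝ) + 1)⁻¹ (v k ω)])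
          (by positivity)
      linarith [hp k]
    · rw [Set.indicator_of_notMem (by exact hω)]
      refine tendsto_const_nhds.congr fun p => ?_
      push Not at hω
      obtain ⟨k, hk⟩ := hω
      symm
      refine Finset.prod_eq_zero (Finset.mem_univ k) (hz _ ?_)
      have hp : (0 : ℝ) < (p : ℝ) + 1 := by positivity
      have h2 := smoothNorm_le (inv_pos.2 hp).le (v k ω)
      have h3 : ((p : ℝ) + 1) * (smoothNorm ((p : ℝ) + 1)⁻¹ (v k ω) + r k ω - t) ≤
          ((p : ℝ) + 1) * ((p : ℝ) + 1)⁻¹ :=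
        mul_le_mul_of_nonneg_left (by linarith) hp.le
      rw [mul_inv_cancel₀ hp.ne'] at h3
      linarith

/-- Gordon's comparison inequality for the bilinear Gaussian process on a finite set of unit
vectors times the sphere. -/
theorem gordon_comparison {m n : ℕ} {X : Type*} [Fintype X] (x : X → Fin n → ℝ)
    (hx : ∀ k, ∑ j, x k j ^ 2 = 1) (t : ℝ) :
    (stdGaussianPi ((Fin m × Fin n ⊕ Unit) ⊕ (Fin m ⊕ Fin n))).real
      {z | ∀ k, t < ‖WithLp.toLp 2 fun i => z (.inr (.inl i))‖ + ∑ j, z (.inr (.inr j)) * x k j} ≤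
    (stdGaussianPi ((Fin m × Fin n ⊕ Unit) ⊕ (Fin m ⊕ Fin n))).real
      {z | ∀ k, t < mulVecNorm (Matrix.of fun i j => z (.inl (.inl (i, j)))) (x k) +
        z (.inl (.inr ()))} := by
  obtain ⟨f, f', f'', C, D, hf, hf', hf'', h0, h1, h0', hC, hD, hz, ho⟩ := exists_smooth_step
  have hfc : Continuous f := continuous_iff_continuousAt.2 fun w => (hf w).continuousAt
  have T1 := tendsto_integral_prod_step hfc h0 h1 hz ho (X := X)
    (P := stdGaussianPi ((Fin m × Fin n ⊕ Unit) ⊕ (Fin m ⊕ Fin n)))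
    (v := fun _ z => WithLp.toLp 2 fun i => z (.inr (.inl i)))
    (r := fun k z => ∑ j, z (.inr (.inr j)) * x k j) (fun k => by fun_prop)
    (fun k => by fun_prop) t
  have hA : ∀ k, Measurable fun z : (Fin m × Fin n ⊕ Unit) ⊕ (Fin m ⊕ Fin n) → ℝ =>
      WithLp.toLp 2 ((Matrix.of fun i j => z (.inl (.inl (i, j)))).mulVec (x k)) := by
    intro k
    refine Continuous.measurable ?_
    change Continuous fun z : (Fin m × Fin n ⊕ Unit) ⊕ (Fin m ⊕ Fin n) → ℝ =>
      WithLp.toLp 2 fun i => ∑ j, z (.inl (.inl (i, j))) * x k j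
    fun_prop
  have T2 := tendsto_integral_prod_step hfc h0 h1 hz ho (X := X)
    (P := stdGaussianPi ((Fin m × Fin n ⊕ Unit) ⊕ (Fin m ⊕ Fin n)))
    (r := fun k z => z (.inl (.inr ()))) hA (fun k => by fun_prop) t
  refine le_of_tendsto_of_tendsto' T1 T2 fun p => ?_
  have hl : ∀ s, HasDerivAt (fun s => ((p : ℝ) + 1) * (s - t) - 1) ((p : ℝ) + 1) s := fun s => by
    simpa using (((hasDerivAt_id s).sub_const t).const_mul ((p : ℝ) + 1)).sub_const 1
  have hp : (0 : ℝ) < (p : ℝ) + 1 := by positivity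
  have h := gordon_smooth (m := m) x hx (ψ := fun s => f (((p : ℝ) + 1) * (s - t) - 1))
    (ψ' := fun s => f' (((p : ℝ) + 1) * (s - t) - 1) * ((p : ℝ) + 1))
    (ψ'' := fun s => f'' (((p : ℝ) + 1) * (s - t) - 1) * ((p : ℝ) + 1) * ((p : ℝ) + 1))
    (C := C * ((p : ℝ) + 1)) (D := D * ((p : ℝ) + 1) * ((p : ℝ) + 1)) (inv_pos.2 hp)
    (fun s => (hf _).comp s (hl s)) (fun s => ((hf' _).comp s (hl s)).mul_const _)
    (by fun_prop) (fun _ => h0 _) (fun _ => h1 _) (fun _ => mul_nonneg (h0' _) hp.le)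
    (fun s => by
      rw [abs_mul, abs_of_pos hp]; exact mul_le_mul_of_nonneg_right (hC _) hp.le)
    (fun s => by
      rw [abs_mul, abs_mul, abs_of_pos hp]
      exact mul_le_mul_of_nonneg_right (mul_le_mul_of_nonneg_right (hD _) hp.le) hp.le)
  simpa only [sum_smul_decoupledVec, sum_smul_bilinearVec] using h

/-! ### Mean and variance of the norm of a Gaussian vector. -/

theorem stdGaussianPi_eq_withDensity (ι : Type*) [Fintype ι] :
    stdGaussianPi ι = (volume : Measure (ι → ℝ)).withDensity
      fun x => ENNReal.ofReal (∏ i, gaussianPDFReal 0 1 (x i)) := by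
  refine Measure.pi_eq fun s hs => ?_
  rw [withDensity_apply _ (MeasurableSet.univ_pi hs), volume_pi, Measure.restrict_pi_pi,
    ← ofReal_integral_eq_lintegral_ofReal
      (Integrable.fintype_prod fun i => (integrable_gaussianPDFReal 0 1).restrict)
      (ae_of_all _ fun x => Finset.prod_nonneg fun i _ => gaussianPDFReal_nonneg _ _ _),
    integral_fintype_prod_eq_prod (f := fun _ y => gaussianPDFReal 0 1 y),
    ENNReal.ofReal_prod_of_nonneg fun i _ => integral_nonneg fun _ => gaussianPDFReal_nonneg _ _ _]
  exact Finset.prod_congr rfl fun i _ => (gaussianReal_apply_eq_integral 0 one_ne_zero _).symm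

theorem prod_gaussianPDFReal_eq {m : ℕ} (x : Fin m → ℝ) :
    ∏ i, gaussianPDFReal 0 1 (x i) =
      (√(2 * Real.pi))⁻¹ ^ m * Real.exp (-‖WithLp.toLp 2 x‖ ^ 2 / 2) := by
  simp only [gaussianPDFReal, Finset.prod_mul_distrib, ← Real.exp_sum, EuclideanSpace.norm_sq_eq]
  congr 2
  · simp
  · simp [← Finset.sum_div]

/-- Polar coordinates. The constant need not be evaluated, only be the same for all `f`. -/
theorem exists_integral_norm_stdGaussianPi (k : ℕ) : ∃ K : ℝ, ∀ f : ℝ → ℝ,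
    ∫ z, f ‖WithLp.toLp 2 z‖ ∂(stdGaussianPi (Fin (k + 1))) =
      K * ∫ r in Set.Ioi (0 : ℝ), r ^ k * (Real.exp (-r ^ 2 / 2) * f r) := by
  have hm : Measurable fun x : Fin (k + 1) → ℝ => ∏ i, gaussianPDFReal 0 1 (x i) :=
    Finset.measurable_fun_prod _ fun i _ => (measurable_gaussianPDFReal 0 1).comp
      (measurable_pi_apply i)
  refine ⟨(√(2 * Real.pi))⁻¹ ^ (k + 1) * ((k + 1 : ℕ) *
    (volume : Measure (EuclideanSpace ℝ (Fin (k + 1)))).real (Metric.ball 0 1)), fun f => ?_⟩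
  have h := integral_fun_norm_addHaar (volume : Measure (EuclideanSpace ℝ (Fin (k + 1))))
    (fun r => Real.exp (-r ^ 2 / 2) * f r)
  rw [stdGaussianPi_eq_withDensity,
    integral_withDensity_eq_integral_toReal_smul hm.ennreal_ofReal
      (ae_of_all _ fun _ => ENNReal.ofReal_lt_top)]
  have e : ∀ x : Fin (k + 1) → ℝ, (ENNReal.ofReal (∏ i, gaussianPDFReal 0 1 (x i))).toReal •
      f ‖WithLp.toLp 2 x‖ = (fun y : EuclideanSpace ℝ (Fin (k + 1)) =>
        (√(2 * Real.pi))⁻¹ ^ (k + 1) * (Real.exp (-‖y‖ ^ 2 / 2) * f ‖y‖)) (WithLp.toLp 2 x) := by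
    intro x
    rw [ENNReal.toReal_ofReal (Finset.prod_nonneg fun i _ => gaussianPDFReal_nonneg _ _ _),
      prod_gaussianPDFReal_eq, smul_eq_mul]
    ring
  simp_rw [e]
  rw [(PiLp.volume_preserving_toLp (Fin (k + 1))).integral_comp
    (MeasurableEquiv.toLp 2 _).measurableEmbedding
    (fun y : EuclideanSpace ℝ (Fin (k + 1)) =>
        (√(2 * Real.pi))⁻¹ ^ (k + 1) * (Real.exp (-‖y‖ ^ 2 / 2) * f ‖y‖)),
    integral_const_mul, h]
  simp
  ring

theorem integral_eval_sq_stdGaussianPi {ι : Type*} [Fintype ι] (i : ι) :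
    ∫ z : ι → ℝ, z i ^ 2 ∂(stdGaussianPi ι) = 1 := by
  have h := integral_comp_eval (μ := fun _ : ι => gaussianReal 0 1) (i := i)
    (f := fun x : ℝ => x ^ 2) (by fun_prop)
  rw [h]
  have hv := variance_fun_id_gaussianReal (μ := 0) (v := 1)
  rw [variance_eq_integral measurable_id'.aemeasurable] at hv
  simpa using hv

theorem memLp_norm_toLp {m : ℕ} :
    MemLp (fun z : Fin m → ℝ => ‖WithLp.toLp 2 z‖) 2 (stdGaussianPi (Fin m)) := by
  refine (memLp_two_iff_integrable_sq (by fun_prop)).2 ?_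
  simp only [EuclideanSpace.norm_sq_eq, Real.norm_eq_abs, sq_abs]
  exact integrable_finsetSum _ fun i _ => (memLp_eval_stdGaussianPi i 2).integrable_sq

theorem integral_norm_sq_stdGaussianPi (m : ℕ) :
    ∫ z, ‖WithLp.toLp 2 z‖ ^ 2 ∂(stdGaussianPi (Fin m)) = m := by
  simp only [EuclideanSpace.norm_sq_eq, Real.norm_eq_abs, sq_abs]
  rw [integral_finsetSum _ fun i _ => (memLp_eval_stdGaussianPi i 2).integrable_sq]
  simp [integral_eval_sq_stdGaussianPi]

/-- The mean of the Euclidean norm of a standard Gaussian vector. -/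
noncomputable def chiMean (m : ℕ) : ℝ := ∫ z, ‖WithLp.toLp 2 z‖ ∂(stdGaussianPi (Fin m))

theorem chiMean_nonneg (m : ℕ) : 0 ≤ chiMean m := integral_nonneg fun _ => norm_nonneg _

theorem variance_norm_stdGaussianPi (m : ℕ) :
    Var[fun z => ‖WithLp.toLp 2 z‖; stdGaussianPi (Fin m)] = m - chiMean m ^ 2 := by
  rw [variance_eq_sub memLp_norm_toLp, ← integral_norm_sq_stdGaussianPi m]
  rfl

theorem chiMean_le_sqrt (m : ℕ) : chiMean m ≤ √m := by
  refine Real.le_sqrt_of_sq_le ?_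
  have := variance_nonneg (fun z => ‖WithLp.toLp 2 z‖) (stdGaussianPi (Fin m))
  rw [variance_norm_stdGaussianPi] at this
  linarith

/-- In polar coordinates raising the dimension by one adds a factor `r`. The mean norm in dimension
`m` and the total mass in dimension `m + 1` share the radial integral `I`; the second moment in
dimension `m` and the mean norm in dimension `m + 1` share `J`. So the product is `(L I)(K J) = 1 ·
m`. -/
theorem chiMean_mul_chiMean_succ {m : ℕ} (hm : 0 < m) : chiMean m * chiMean (m + 1) = m := by
  obtain ⟨k, rfl⟩ := Nat.exists_eq_add_one.2 hm
  obtain ⟨K, hK⟩ := exists_integral_norm_stdGaussianPi k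
  obtain ⟨L, hL⟩ := exists_integral_norm_stdGaussianPi (k + 1)
  have h1 := hK fun r => r
  have h2 := hK fun r => r ^ 2
  have h3 := hL fun r => 1
  have h4 := hL fun r => r
  rw [integral_norm_sq_stdGaussianPi] at h2
  simp only [integral_const, probReal_univ, smul_eq_mul, mul_one] at h3
  have e1 : ∀ r : ℝ, r ^ k * (Real.exp (-r ^ 2 / 2) * r) = r ^ (k + 1) * Real.exp (-r ^ 2 / 2) :=
    fun r => by ring
  have e2 : ∀ r : ℝ, r ^ k * (Real.exp (-r ^ 2 / 2) * r ^ 2) =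
    r ^ (k + 1) * (Real.exp (-r ^ 2 / 2) * r) := fun r => by ring
  simp only [e1] at h1
  simp only [e2] at h2
  rw [chiMean, chiMean, h1, h4, h2]
  set I := ∫ r in Set.Ioi (0 : ℝ), r ^ (k + 1) * Real.exp (-r ^ 2 / 2)
  set J := ∫ r in Set.Ioi (0 : ℝ), r ^ (k + 1) * (Real.exp (-r ^ 2 / 2) * r)
  calc K * I * (L * J) = (L * I) * (K * J) := by ring
    _ = K * J := by rw [← h3, one_mul]

theorem chiMean_pos {m : ℕ} (hm : 0 < m) : 0 < chiMean m := by
  refine (chiMean_nonneg m).lt_of_ne fun h => ?_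
  have := chiMean_mul_chiMean_succ hm
  rw [← h, zero_mul] at this
  exact hm.ne' (by exact_mod_cast this.symm)

theorem chiMean_add_two {m : ℕ} (hm : 0 < m) : (m : ℝ) * chiMean (m + 2) = (m + 1) * chiMean m := by
  have h1 := chiMean_mul_chiMean_succ hm
  have h2 := chiMean_mul_chiMean_succ (Nat.succ_pos m)
  have h3 := chiMean_pos (Nat.succ_pos m)
  push_cast at h2
  refine mul_right_cancel₀ h3.ne' ?_
  simp only [Nat.succ_eq_add_one] at *
  rw [show m + 1 + 1 = m + 2 from rfl] at h2
  calc (m : ℝ) * chiMean (m + 2) * chiMean (m + 1) = m * (chiMean (m + 1) * chiMean (m + 2)) := by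
        ring
    _ = (m + 1) * (chiMean m * chiMean (m + 1)) := by rw [h1, h2]; ring
    _ = _ := by ring

/-- The lower bound `√m - 1 / (4 √m)` in a form without subtraction of quotients. -/
theorem sqrt_sub_eq {m : ℕ} (hm : 0 < m) :
    √(m : ℝ) - 1 / (4 * √(m : ℝ)) = (4 * m - 1) / (4 * √(m : ℝ)) := by
  have h : 0 < √(m : ℝ) := Real.sqrt_pos.2 (by exact_mod_cast hm)
  have h2 : √(m : ℝ) * √(m : ℝ) = m := Real.mul_self_sqrt (by positivity)
  field_simp
  linarith

/-- Compared with `chiMean_add_two`, this says that the ratio of `chiMean` to its proposed lower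
bound does not increase when `m` grows by two. -/
theorem chi_bound_step {m : ℕ} (hm : 0 < m) :
    ((m : ℝ) + 1) * ((4 * m - 1) / (4 * √(m : ℝ))) ≤
      m * ((4 * (m + 2 : ℕ) - 1) / (4 * √((m + 2 : ℕ) : ℝ))) := by
  have hm1 : (1 : ℝ) ≤ m := by exact_mod_cast hm
  push_cast
  set s := √(m : ℝ) with hs
  set t := √((m : ℝ) + 2) with ht
  have hs0 : 0 < s := Real.sqrt_pos.2 (by linarith)
  have ht0 : 0 < t := Real.sqrt_pos.2 (by linarith)
  have hs2 : s ^ 2 = m := Real.sq_sqrt (by linarith)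
  have ht2 : t ^ 2 = m + 2 := Real.sq_sqrt (by linarith)
  -- After squaring, the terms of degree five, four and three in `m` cancel, and `4m² + 11m - 2 ≥ 0`
  -- remains; the constant `1/4` is chosen for this.
  have key : ((m : ℝ) + 1) * (4 * m - 1) * t ≤ m * (4 * m + 7) * s := by
    refine abs_le_of_sq_le_sq' ?_ (by positivity) |>.2
    rw [mul_pow, mul_pow _ s, hs2, ht2]
    nlinarith
  rw [mul_div_assoc', mul_div_assoc', div_le_div_iff₀ (by positivity) (by positivity)]
  nlinarith

/-- The ratio of `chiMean` to the bound does not increase along `m, m + 2, m + 4, …`, and its values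
there are bounded below by a sequence tending to `1`. Hence it is at least `1` at the start. -/
theorem le_chiMean {m : ℕ} (hm : 0 < m) : √(m : ℝ) - 1 / (4 * √(m : ℝ)) ≤ chiMean m := by
  set l : ℕ → ℝ := fun m => (4 * m - 1) / (4 * √(m : ℝ)) with hl
  have hlpos : ∀ m : ℕ, 0 < m → 0 < l m := by
    intro m hm
    have hm1 : (1 : ℝ) ≤ m := by exact_mod_cast hm
    exact div_pos (by linarith) (mul_pos (by norm_num) (Real.sqrt_pos.2 (by linarith)))
  have hdec : ∀ j : ℕ, chiMean (m + 2 * j) / l (m + 2 * j) ≤ chiMean m / l m := by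
    intro j
    induction j with
    | zero => simp
    | succ j ih =>
      refine le_trans ?_ ih
      set M := m + 2 * j with hM
      have hM0 : 0 < M := by omega
      have hMr : (0 : ℝ) < M := by exact_mod_cast hM0
      rw [show m + 2 * (j + 1) = M + 2 by omega,
        div_le_div_iff₀ (hlpos _ (by omega)) (hlpos _ hM0)]
      have h1 := chiMean_add_two hM0
      have h2 := mul_le_mul_of_nonneg_right (chi_bound_step hM0) (chiMean_nonneg M)
      refine le_of_mul_le_mul_left ?_ hMr
      calc (M : ℝ) * (chiMean (M + 2) * l M) = (M * chiMean (M + 2)) * l M := by ring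
        _ = (M + 1) * l M * chiMean M := by rw [h1]; ring
        _ ≤ M * l (M + 2) * chiMean M := h2
        _ = M * (chiMean M * l (M + 2)) := by ring
  -- The crude estimate `chiMean M = M / chiMean (M + 1) ≥ M / √(M + 1)`, with `l M ≤ √M`, suffices
  -- in the limit.
  have hlow : ∀ j : ℕ, √(((m + 2 * j : ℕ) : ℝ) / ((m + 2 * j : ℕ) + 1)) ≤ chiMean m / l m := by
    intro j
    refine le_trans ?_ (hdec j)
    set M := m + 2 * j with hM
    have hM0 : 0 < M := by omega
    have hMr : (0 : ℝ) < M := by exact_mod_cast hM0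
    have hs : 0 < √(M : ℝ) := Real.sqrt_pos.2 hMr
    have h1 := chiMean_mul_chiMean_succ hM0
    have h2 := chiMean_le_sqrt (M + 1)
    have hll : l M ≤ √(M : ℝ) := by
      rw [hl]; simp only
      rw [← sqrt_sub_eq hM0]
      have : 0 < 1 / (4 * √(M : ℝ)) := by positivity
      linarith
    push_cast at h2
    have ht : 0 < √((M : ℝ) + 1) := Real.sqrt_pos.2 (by linarith)
    rw [Real.sqrt_div hMr.le, div_le_div_iff₀ ht (hlpos _ hM0)]
    calc √(M : ℝ) * l M ≤ √(M : ℝ) * √(M : ℝ) := mul_le_mul_of_nonneg_left hll hs.le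
      _ = chiMean M * chiMean (M + 1) := by rw [h1, Real.mul_self_sqrt hMr.le]
      _ ≤ chiMean M * √((M : ℝ) + 1) := mul_le_mul_of_nonneg_left h2 (chiMean_nonneg _)
  have hlim : Tendsto (fun j : ℕ => √(((m + 2 * j : ℕ) : ℝ) / ((m + 2 * j : ℕ) + 1))) atTop
      (𝓝 √1) := by
    refine (Real.continuous_sqrt.tendsto 1).comp ?_
    refine (tendsto_natCast_div_add_atTop (𝕜 := ℝ) 1).comp ?_
    exact tendsto_atTop_mono (fun j => by simp only [id]; omega) tendsto_id
  have := le_of_tendsto' hlim hlow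
  rw [Real.sqrt_one, le_div_iff₀ (hlpos _ hm), one_mul] at this
  rw [sqrt_sub_eq hm]
  exact this

/-- Since `(√m - 1/(4√m))² ≥ m - 1/2`, the mean is so close to `√m` that the variance stays bounded
in `m`. -/
theorem variance_norm_stdGaussianPi_le {m : ℕ} (hm : 0 < m) :
    Var[fun z => ‖WithLp.toLp 2 z‖; stdGaussianPi (Fin m)] ≤ 1 := by
  rw [variance_norm_stdGaussianPi]
  have hm1 : (1 : ℝ) ≤ m := by exact_mod_cast hm
  have h := le_chiMean hm
  set s := √(m : ℝ) with hs
  have hs1 : 1 ≤ s := Real.one_le_sqrt.2 hm1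
  have hs2 : s ^ 2 = m := Real.sq_sqrt (by linarith)
  have e : s * (1 / (4 * s)) = 1 / 4 := by field_simp
  have hi : 1 / (4 * s) ≤ 1 := by
    rw [div_le_one (by positivity)]; linarith
  have : (s - 1 / (4 * s)) ^ 2 ≤ chiMean m ^ 2 := pow_le_pow_left₀ (by linarith) h 2
  nlinarith [sq_nonneg (1 / (4 * s))]

/-! ### Gaussian marginals and sums of absolute values. -/

theorem measurePreserving_comp_stdGaussianPi {ι κ : Type*} [Fintype ι] [Fintype κ] {e : κ → ι}
    (he : Function.Injective e) :
    MeasurePreserving (fun (z : ι → ℝ) k => z (e k)) (stdGaussianPi ι) (stdGaussianPi κ) := by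
  refine ⟨by fun_prop, ?_⟩
  have h : iIndepFun (fun (i : ι) (z : ι → ℝ) => z i) (stdGaussianPi ι) :=
    iIndepFun_pi (X := fun _ => id) fun _ => aemeasurable_id
  rw [(h.precomp he).map_fun_eq_pi_map fun k => (measurable_pi_apply (e k)).aemeasurable]
  congr 1
  ext1 k
  exact (measurePreserving_eval (fun _ : ι => gaussianReal 0 1) (e k)).map_eq

theorem integral_abs_gaussianReal : ∫ x, |x| ∂(gaussianReal 0 1) = √(2 / Real.pi) := by
  rw [integral_gaussianReal_eq_integral_smul one_ne_zero]
  have e : ∀ x : ℝ, gaussianPDFReal 0 1 x • |x| =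
      (fun y : ℝ => (√(2 * Real.pi))⁻¹ * (y * Real.exp (-y ^ 2 / 2))) |x| := by
    intro x
    simp [gaussianPDFReal]
    ring
  simp_rw [e]
  rw [integral_comp_abs (f := fun y : ℝ => (√(2 * Real.pi))⁻¹ * (y * Real.exp (-y ^ 2 / 2))),
    integral_const_mul]
  have h := integral_rpow_mul_exp_neg_mul_rpow (p := 2) (q := 1) (b := 1 / 2) two_pos
    (by norm_num) (by norm_num)
  norm_num at h
  have e2 : ∀ y : ℝ, y * Real.exp (-y ^ 2 / 2) = y * Real.exp (-(1 / 2 * y ^ 2)) := fun y => by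
    congr 2; ring
  have h' : ∫ y in Set.Ioi (0 : ℝ), y * Real.exp (-y ^ 2 / 2) = 1 := by
    simp_rw [e2]
    exact h
  rw [h', mul_one, Real.sqrt_div zero_le_two, Real.sqrt_mul zero_le_two]
  have h2 : √2 * √2 = (2 : ℝ) := Real.mul_self_sqrt zero_le_two
  have : 0 < √Real.pi := Real.sqrt_pos.2 Real.pi_pos
  field_simp
  linarith

theorem memLp_abs_gaussianReal : MemLp (fun x : ℝ => |x|) 2 (gaussianReal 0 1) :=
  (memLp_id_gaussianReal (μ := 0) (v := 1) 2).norm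

theorem integral_sum_abs_stdGaussianPi (n : ℕ) :
    ∫ z : Fin n → ℝ, ∑ j, |z j| ∂(stdGaussianPi (Fin n)) = n * √(2 / Real.pi) := by
  rw [integral_finsetSum _ fun j _ => (integrable_eval_stdGaussianPi j).abs]
  have : ∀ j : Fin n, ∫ z : Fin n → ℝ, |z j| ∂(stdGaussianPi (Fin n)) = √(2 / Real.pi) := by
    intro j
    rw [← integral_abs_gaussianReal]
    exact integral_comp_eval (μ := fun _ : Fin n => gaussianReal 0 1) (i := j)
      (f := fun x : ℝ => |x|) (by fun_prop)
  simp [this]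

theorem memLp_sum_abs (n : ℕ) :
    MemLp (fun z : Fin n → ℝ => ∑ j, |z j|) 2 (stdGaussianPi (Fin n)) :=
  memLp_finsetSum _ fun j _ => (memLp_eval_stdGaussianPi j 2).norm

theorem variance_sum_abs_stdGaussianPi_le (n : ℕ) :
    Var[fun z : Fin n → ℝ => ∑ j, |z j|; stdGaussianPi (Fin n)] ≤ n := by
  have h := variance_sum_pi (μ := fun _ : Fin n => gaussianReal 0 1)
    (X := fun _ x => |x|) fun _ => memLp_abs_gaussianReal
  have e : (fun z : Fin n → ℝ => ∑ j, |z j|) = ∑ j, fun z : Fin n → ℝ => |z j| := by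
    ext z; simp
  have h1 : Var[fun x : ℝ => |x|; gaussianReal 0 1] ≤ 1 := by
    refine (variance_le_expectation_sq (by fun_prop)).trans (le_of_eq ?_)
    have hv := variance_fun_id_gaussianReal (μ := 0) (v := 1)
    rw [variance_eq_integral measurable_id'.aemeasurable] at hv
    simpa using hv
  rw [e, h]
  simpa using Finset.sum_le_sum fun (j : Fin n) (_ : j ∈ Finset.univ) => h1

/-! ### Comparison of means from comparison of tails. -/

theorem lintegral_ofReal_eq_lintegral_meas_lt {Ω : Type*} [MeasurableSpace Ω] (P : Measure Ω)
    {Y : Ω → ℝ} (hY : Measurable Y) :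
    ∫⁻ ω, ENNReal.ofReal (Y ω) ∂P = ∫⁻ t in Set.Ioi (0 : ℝ), P {ω | t < Y ω} := by
  have h := lintegral_eq_lintegral_meas_lt P (f := fun ω => max (Y ω) 0)
    (ae_of_all _ fun _ => le_max_right _ _) (by fun_prop)
  simp only [ENNReal.ofReal_max, ENNReal.ofReal_zero, zero_le, max_eq_left] at h
  rw [h]
  refine setLIntegral_congr_fun measurableSet_Ioi fun t ht => ?_
  have ht : ¬ t < 0 := not_lt.2 (le_of_lt ht)
  simp [ht]

theorem lintegral_ofReal_neg_eq_lintegral_meas_le {Ω : Type*} [MeasurableSpace Ω] (P : Measure Ω)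
    {Y : Ω → ℝ} (hY : Measurable Y) :
    ∫⁻ ω, ENNReal.ofReal (-Y ω) ∂P = ∫⁻ t in Set.Ioi (0 : ℝ), P {ω | Y ω ≤ -t} := by
  have h := lintegral_eq_lintegral_meas_le P (f := fun ω => max (-Y ω) 0)
    (ae_of_all _ fun _ => le_max_right _ _) (by fun_prop)
  simp only [ENNReal.ofReal_max, ENNReal.ofReal_zero, zero_le, max_eq_left] at h
  rw [h]
  refine setLIntegral_congr_fun measurableSet_Ioi fun t ht => ?_
  have ht : ¬ t ≤ 0 := not_le.2 ht
  simp [ht, le_neg]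

/-- The variables are signed, so the layer-cake formula is applied to positive and negative parts
separately; the negative parts use the complementary events. -/
theorem integral_le_of_forall_measure_lt_le {Ω Ω' : Type*} [MeasurableSpace Ω] [MeasurableSpace Ω']
    {P : Measure Ω} {Q : Measure Ω'} [IsProbabilityMeasure P] [IsProbabilityMeasure Q]
    {Y : Ω → ℝ} {X : Ω' → ℝ} (hYm : Measurable Y) (hXm : Measurable X) (hY : Integrable Y P)
    (hX : Integrable X Q) (h : ∀ t, P {ω | t < Y ω} ≤ Q {ω | t < X ω}) :
    ∫ ω, Y ω ∂P ≤ ∫ ω, X ω ∂Q := by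
  have h' : ∀ t, Q {ω | X ω ≤ t} ≤ P {ω | Y ω ≤ t} := by
    intro t
    have e1 : {ω | X ω ≤ t} = {ω | t < X ω}ᶜ := by ext; simp
    have e2 : {ω | Y ω ≤ t} = {ω | t < Y ω}ᶜ := by ext; simp
    rw [e1, e2, prob_compl_eq_one_sub (measurableSet_lt measurable_const hXm),
      prob_compl_eq_one_sub (measurableSet_lt measurable_const hYm)]
    exact tsub_le_tsub_left (h t) 1
  rw [integral_eq_lintegral_pos_part_sub_lintegral_neg_part hY,
    integral_eq_lintegral_pos_part_sub_lintegral_neg_part hX]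
  refine sub_le_sub (ENNReal.toReal_mono hX.lintegral_lt_top.ne ?_)
    (ENNReal.toReal_mono hY.neg.lintegral_lt_top.ne ?_)
  · rw [lintegral_ofReal_eq_lintegral_meas_lt P hYm, lintegral_ofReal_eq_lintegral_meas_lt Q hXm]
    exact lintegral_mono fun t => h t
  · change _ ≤ ∫⁻ ω, ENNReal.ofReal (-Y ω) ∂P
    rw [lintegral_ofReal_neg_eq_lintegral_meas_le P hYm,
      lintegral_ofReal_neg_eq_lintegral_meas_le Q hXm]
    exact lintegral_mono fun t => h' (-t)

/-! ### The minimum over the cube and its Gordon bound. -/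

theorem sum_sq_of_mem_scaledCube {n : ℕ} (hn : 0 < n) {x : Fin n → ℝ} (hx : x ∈ scaledCube n) :
    ∑ j, x j ^ 2 = 1 := by
  have h : ∀ j, x j ^ 2 = 1 / n := by
    intro j
    rcases hx j with h | h <;> rw [h] <;> simp
  have : (n : ℝ) ≠ 0 := by exact_mod_cast hn.ne'
  simp [h, this]

theorem abs_of_mem_scaledCube {n : ℕ} {x : Fin n → ℝ} (hx : x ∈ scaledCube n) (j : Fin n) :
    |x j| = 1 / √(n : ℝ) := by
  have h0 : 0 ≤ 1 / √(n : ℝ) := by positivity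
  rcases hx j with h | h <;> rw [h]
  · rw [abs_neg, abs_of_nonneg h0]
  · rw [abs_of_nonneg h0]

theorem lt_cubeMin_iff {m n : ℕ} (A : Matrix (Fin m) (Fin n) ℝ) (t : ℝ) :
    t < cubeMin A ↔ ∀ x ∈ scaledCube n, t < mulVecNorm A x := by
  obtain ⟨⟨x, hx, hxe⟩, hle⟩ := isLeast_cubeMin A
  constructor
  · exact fun h y hy => h.trans_le (hle ⟨y, hy, rfl⟩)
  · intro h
    rw [← hxe]
    exact h x hx

theorem cubeMin_nonneg {m n : ℕ} (A : Matrix (Fin m) (Fin n) ℝ) : 0 ≤ cubeMin A := by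
  obtain ⟨x, -, hxe⟩ := (isLeast_cubeMin A).1
  rw [← hxe]
  exact norm_nonneg _

/-- The minimum over the cube, as a function of the matrix entries. -/
noncomputable def entryCubeMin {m n : ℕ} (z : Fin m × Fin n → ℝ) : ℝ :=
  cubeMin (Matrix.of fun i j => z (i, j))

theorem measurable_mulVecNorm {m n : ℕ} (x : Fin n → ℝ) :
    Measurable fun z : Fin m × Fin n → ℝ => mulVecNorm (Matrix.of fun i j => z (i, j)) x := by
  refine Continuous.measurable ?_
  change Continuous fun z : Fin m × Fin n → ℝ => ‖WithLp.toLp 2 fun i => ∑ j, z (i, j) * x j‖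
  fun_prop

theorem measurable_entryCubeMin {m n : ℕ} :
    Measurable (entryCubeMin : (Fin m × Fin n → ℝ) → ℝ) := by
  have : Finite (scaledCube n) := (scaledCube_finite n).to_subtype
  have e : (entryCubeMin : (Fin m × Fin n → ℝ) → ℝ) = fun z =>
      ⨅ x : scaledCube n, mulVecNorm (Matrix.of fun i j => z (i, j)) x.1 := by
    ext z
    rw [entryCubeMin, cubeMin, sInf_image']
  rw [e]
  exact Measurable.iInf fun x => measurable_mulVecNorm x.1

theorem integrable_mulVecNorm {m n : ℕ} (x : Fin n → ℝ) :
    Integrable (fun z => mulVecNorm (Matrix.of fun i j => z (i, j)) x)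
      (stdGaussianPi (Fin m × Fin n)) := by
  refine MemLp.integrable (q := 2) (by norm_num) ?_
  refine (memLp_two_iff_integrable_sq (measurable_mulVecNorm x).aestronglyMeasurable).2 ?_
  have e : ∀ z : Fin m × Fin n → ℝ, mulVecNorm (Matrix.of fun i j => z (i, j)) x ^ 2 =
      ∑ i, (∑ j, z (i, j) * x j) ^ 2 := by
    intro z
    simp [mulVecNorm, EuclideanSpace.norm_sq_eq, Matrix.mulVec, dotProduct]
  simp only [e]
  refine integrable_finsetSum _ fun i _ => MemLp.integrable_sq ?_
  exact memLp_finsetSum _ fun j _ => (memLp_eval_stdGaussianPi (i, j) 2).mul_const (x j)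

theorem integrable_entryCubeMin (m n : ℕ) :
    Integrable entryCubeMin (stdGaussianPi (Fin m × Fin n)) := by
  obtain ⟨x, hx⟩ := scaledCube_nonempty n
  refine (integrable_mulVecNorm x).mono' measurable_entryCubeMin.aestronglyMeasurable
    (ae_of_all _ fun z => ?_)
  rw [entryCubeMin, Real.norm_of_nonneg (cubeMin_nonneg _)]
  exact (isLeast_cubeMin _).2 ⟨x, hx, rfl⟩

/-- Since `|x j| = 1/√n` on the cube, `∑ h j * x j ≥ -(∑ |h j|)/√n` for every `x`, which gives one
lower bound valid for all vertices at once. -/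
theorem gordon_cubeMin {m n : ℕ} (hn : 0 < n) (t : ℝ) :
    stdGaussianPi ((Fin m × Fin n ⊕ Unit) ⊕ (Fin m ⊕ Fin n))
      {z | t < ‖WithLp.toLp 2 fun i => z (.inr (.inl i))‖ -
        (∑ j, |z (.inr (.inr j))|) / √(n : ℝ)} ≤
    stdGaussianPi ((Fin m × Fin n ⊕ Unit) ⊕ (Fin m ⊕ Fin n))
      {z | t < entryCubeMin (fun p => z (.inl (.inl p))) + z (.inl (.inr ()))} := by
  have : Fintype (scaledCube n) := (scaledCube_finite n).fintype
  have h := gordon_comparison (m := m) (fun x : scaledCube n => x.1)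
    (fun x => sum_sq_of_mem_scaledCube hn x.2) t
  rw [measureReal_def, measureReal_def,
    ENNReal.toReal_le_toReal (measure_ne_top _ _) (measure_ne_top _ _)] at h
  refine (measure_mono fun z hz x => ?_).trans (h.trans (measure_mono fun z hz => ?_))
  · refine lt_of_lt_of_le hz ?_
    have : -((∑ j, |z (.inr (.inr j))|) / √(n : ℝ)) ≤ ∑ j, z (.inr (.inr j)) * x.1 j := by
      rw [Finset.sum_div, ← Finset.sum_neg_distrib]
      refine Finset.sum_le_sum fun j _ => ?_
      have := neg_abs_le (z (.inr (.inr j)) * x.1 j)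
      rwa [abs_mul, abs_of_mem_scaledCube x.2, mul_one_div] at this
    linarith
  · have hz' : t - z (.inl (.inr ())) < entryCubeMin (fun p => z (.inl (.inl p))) := by
      refine (lt_cubeMin_iff _ _).2 fun x hx => ?_
      have := hz ⟨x, hx⟩
      simp only at this
      linarith
    show t < _
    linarith

section Marginals

variable {m n : ℕ}

theorem measurePreserving_entries :
    MeasurePreserving (fun (z : (Fin m × Fin n ⊕ Unit) ⊕ (Fin m ⊕ Fin n) → ℝ) p =>
      z (.inl (.inl p))) (stdGaussianPi _) (stdGaussianPi (Fin m × Fin n)) :=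
  measurePreserving_comp_stdGaussianPi (Sum.inl_injective.comp Sum.inl_injective)

theorem measurePreserving_left :
    MeasurePreserving (fun (z : (Fin m × Fin n ⊕ Unit) ⊕ (Fin m ⊕ Fin n) → ℝ) i =>
      z (.inr (.inl i))) (stdGaussianPi _) (stdGaussianPi (Fin m)) :=
  measurePreserving_comp_stdGaussianPi (Sum.inr_injective.comp Sum.inl_injective)

theorem measurePreserving_right :
    MeasurePreserving (fun (z : (Fin m × Fin n ⊕ Unit) ⊕ (Fin m ⊕ Fin n) → ℝ) j =>
      z (.inr (.inr j))) (stdGaussianPi _) (stdGaussianPi (Fin n)) :=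
  measurePreserving_comp_stdGaussianPi (Sum.inr_injective.comp Sum.inr_injective)

end Marginals

/-! ### Mean and lower tail of the minimum. -/

theorem MeasureTheory.MeasurePreserving.integral_comp_of_aestronglyMeasurable {α β : Type*}
    [MeasurableSpace α] [MeasurableSpace β] {μ : Measure α} {ν : Measure β} {φ : α → β}
    (h : MeasurePreserving φ μ ν) {f : β → ℝ} (hf : AEStronglyMeasurable f ν) :
    ∫ x, f (φ x) ∂μ = ∫ y, f y ∂ν := by
  rw [← h.map_eq] at hf ⊢
  exact (integral_map h.measurable.aemeasurable hf).symm

theorem le_integral_entryCubeMin {m n : ℕ} (hn : 0 < n) :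
    chiMean m - √(n : ℝ) * √(2 / Real.pi) ≤
      ∫ z, entryCubeMin z ∂(stdGaussianPi (Fin m × Fin n)) := by
  set γ := stdGaussianPi ((Fin m × Fin n ⊕ Unit) ⊕ (Fin m ⊕ Fin n))
  have hE := measurePreserving_entries (m := m) (n := n)
  have hL := measurePreserving_left (m := m) (n := n)
  have hR := measurePreserving_right (m := m) (n := n)
  have i1 : Integrable (fun z : Fin m → ℝ => ‖WithLp.toLp 2 z‖) (stdGaussianPi (Fin m)) :=
    memLp_norm_toLp.integrable (by norm_num)
  have i2 : Integrable (fun z : Fin n → ℝ => ∑ j, |z j|) (stdGaussianPi (Fin n)) :=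
    (memLp_sum_abs n).integrable (by norm_num)
  have i3 := integrable_entryCubeMin m n
  have j1 : Integrable (fun z => ‖WithLp.toLp 2 fun i => z (.inr (.inl i))‖) γ :=
    hL.integrable_comp_of_integrable i1
  have j2 : Integrable (fun z => ∑ j, |z (.inr (.inr j))|) γ :=
    hR.integrable_comp_of_integrable i2
  have j3 : Integrable (fun z => entryCubeMin fun p => z (.inl (.inl p))) γ :=
    hE.integrable_comp_of_integrable i3
  have j4 : Integrable (fun z => z (.inl (.inr ()))) γ := integrable_eval_stdGaussianPi _
  have m3 : Measurable fun z : (Fin m × Fin n ⊕ Unit) ⊕ (Fin m ⊕ Fin n) → ℝ =>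
      entryCubeMin fun p => z (.inl (.inl p)) := measurable_entryCubeMin.comp hE.measurable
  have key := integral_le_of_forall_measure_lt_le (P := γ) (Q := γ) (by fun_prop) (by fun_prop)
    (j1.sub (j2.div_const _)) (j3.add j4) (gordon_cubeMin (m := m) hn)
  have e1 := hL.integral_comp_of_aestronglyMeasurable i1.aestronglyMeasurable
  have e2 := hR.integral_comp_of_aestronglyMeasurable i2.aestronglyMeasurable
  have e3 := hE.integral_comp_of_aestronglyMeasurable i3.aestronglyMeasurable
  have e4 : ∫ z, z (.inl (.inr ())) ∂γ = 0 := by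
    rw [← integral_id_gaussianReal (μ := 0) (v := 1)]
    exact integral_comp_eval (μ := fun _ : (Fin m × Fin n ⊕ Unit) ⊕ (Fin m ⊕ Fin n) =>
      gaussianReal 0 1) (i := Sum.inl (Sum.inr ())) (f := fun x : ℝ => x) (by fun_prop)
  rw [integral_sum_abs_stdGaussianPi] at e2
  have hs : (n : ℝ) * √(2 / Real.pi) / √(n : ℝ) = √(n : ℝ) * √(2 / Real.pi) := by
    have h : 0 < √(n : ℝ) := Real.sqrt_pos.2 (by exact_mod_cast hn)
    rw [div_eq_iff h.ne', mul_right_comm, Real.mul_self_sqrt (Nat.cast_nonneg n)]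
  have kl : ∫ z, (‖WithLp.toLp 2 fun i => z (.inr (.inl i))‖ -
      (∑ j, |z (.inr (.inr j))|) / √(n : ℝ)) ∂γ = chiMean m - √(n : ℝ) * √(2 / Real.pi) := by
    rw [integral_sub j1 (j2.div_const _), integral_div, ← hs, ← e2, chiMean, ← e1]
  have kr : ∫ z, (entryCubeMin (fun p => z (.inl (.inl p))) + z (.inl (.inr ()))) ∂γ =
      ∫ z, entryCubeMin z ∂(stdGaussianPi (Fin m × Fin n)) := by
    rw [integral_add j3 j4, e4, add_zero, ← e3]
  rw [← kl, ← kr]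
  exact key

theorem measureReal_le_of_variance_le {Ω : Type*} [MeasurableSpace Ω] {P : Measure Ω}
    [IsProbabilityMeasure P] {X : Ω → ℝ} (hX : MemLp X 2 P) {v d : ℝ} (hv : Var[X; P] ≤ v)
    (hd : 0 < d) : P.real {ω | d ≤ |X ω - ∫ ω, X ω ∂P|} ≤ v / d ^ 2 := by
  have h0 := variance_nonneg X P
  refine (ENNReal.toReal_mono ENNReal.ofReal_ne_top (meas_ge_le_variance_div_sq hX hd)).trans ?_
  rw [ENNReal.toReal_ofReal (by positivity)]
  gcongr

/-- One `d` pays for removing `γ`, one for the deviation of `‖g‖` and one for that of `(∑ |h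
j|)/√n`. Each failure has probability at most `1/d²` by Chebyshev's inequality. -/
theorem measureReal_entryCubeMin_lt_le {m n : ℕ} (hm : 0 < m) (hn : 0 < n) {u d : ℝ} (hd : 0 < d)
    (hu : u + 3 * d ≤ √(m : ℝ) - 1 / (4 * √(m : ℝ)) - √(n : ℝ) * √(2 / Real.pi)) :
    (stdGaussianPi (Fin m × Fin n)).real {z | entryCubeMin z < u} ≤ 3 / d ^ 2 := by
  set γ := stdGaussianPi ((Fin m × Fin n ⊕ Unit) ⊕ (Fin m ⊕ Fin n))
  have hE := measurePreserving_entries (m := m) (n := n)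
  have hL := measurePreserving_left (m := m) (n := n)
  have hR := measurePreserving_right (m := m) (n := n)
  have hsn : 0 < √(n : ℝ) := Real.sqrt_pos.2 (by exact_mod_cast hn)
  have hs2 : √(n : ℝ) * √(n : ℝ) = n := Real.mul_self_sqrt (Nat.cast_nonneg n)
  have m3 : Measurable fun z : (Fin m × Fin n ⊕ Unit) ⊕ (Fin m ⊕ Fin n) → ℝ =>
      entryCubeMin fun p => z (.inl (.inl p)) := measurable_entryCubeMin.comp hE.measurable
  have hchi := le_chiMean hm
  have b1 := measureReal_le_of_variance_le memLp_norm_toLp (variance_norm_stdGaussianPi_le hm) hd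
  have b2 := measureReal_le_of_variance_le (memLp_sum_abs n)
    (variance_sum_abs_stdGaussianPi_le n) (mul_pos hsn hd)
  have b3 : (gaussianReal 0 1).real {x | d ≤ |x - ∫ x, x ∂(gaussianReal 0 1)|} ≤ 1 / d ^ 2 :=
    measureReal_le_of_variance_le (X := fun x => x) (memLp_id_gaussianReal (μ := 0) (v := 1) 2)
      (by simp [variance_fun_id_gaussianReal]) hd
  rw [integral_sum_abs_stdGaussianPi] at b2
  rw [integral_id_gaussianReal] at b3
  -- The sum has variance at most `n` and is allowed to deviate by `√n d`, so the bound is free of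
  -- `n`.
  have hb2 : (n : ℝ) / (√(n : ℝ) * d) ^ 2 = 1 / d ^ 2 := by
    rw [mul_pow, sq √(n : ℝ), hs2]
    have : (n : ℝ) ≠ 0 := by exact_mod_cast hn.ne'
    field_simp
  rw [hb2] at b2
  have c1 := hL.measureReal_preimage (s := {z | d ≤ |‖WithLp.toLp 2 z‖ - chiMean m|})
    (measurableSet_le (by fun_prop) (by fun_prop)).nullMeasurableSet
  have c2 := hR.measureReal_preimage
    (s := {z | √(n : ℝ) * d ≤ |∑ j, |z j| - n * √(2 / Real.pi)|})
    (measurableSet_le (by fun_prop) (by fun_prop)).nullMeasurableSet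
  have c3 := (measurePreserving_eval (fun _ : (Fin m × Fin n ⊕ Unit) ⊕ (Fin m ⊕ Fin n) =>
    gaussianReal 0 1) (.inl (.inr ()))).measureReal_preimage (s := {x | d ≤ |x - 0|})
    (measurableSet_le (by fun_prop) (by fun_prop)).nullMeasurableSet
  have c0 := hE.measureReal_preimage (s := {z | entryCubeMin z < u})
    (measurableSet_lt measurable_entryCubeMin measurable_const).nullMeasurableSet
  have g := gordon_cubeMin (m := m) hn (u + d)
  have g' : γ.real {z | entryCubeMin (fun p => z (.inl (.inl p))) + z (.inl (.inr ())) ≤ u + d} ≤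
      γ.real {z | ‖WithLp.toLp 2 fun i => z (.inr (.inl i))‖ -
        (∑ j, |z (.inr (.inr j))|) / √(n : ℝ) ≤ u + d} := by
    have gr := ENNReal.toReal_mono (measure_ne_top _ _) g
    rw [← measureReal_def, ← measureReal_def] at gr
    have k1 := probReal_compl_eq_one_sub (μ := γ)
      (s := {z | u + d < entryCubeMin (fun p => z (.inl (.inl p))) + z (.inl (.inr ()))})
      (measurableSet_lt (by fun_prop) (by fun_prop))
    have k2 := probReal_compl_eq_one_sub (μ := γ)
      (s := {z | u + d < ‖WithLp.toLp 2 fun i => z (.inr (.inl i))‖ -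
        (∑ j, |z (.inr (.inr j))|) / √(n : ℝ)})
      (measurableSet_lt (by fun_prop) (by fun_prop))
    simp only [Set.compl_ofPred, not_lt] at k1 k2
    rw [k1, k2]
    exact sub_le_sub_left gr 1
  rw [← c0]
  have s1 : (fun (z : (Fin m × Fin n ⊕ Unit) ⊕ (Fin m ⊕ Fin n) → ℝ) p => z (.inl (.inl p))) ⁻¹'
      {z | entryCubeMin z < u} ⊆
      {z | entryCubeMin (fun p => z (.inl (.inl p))) + z (.inl (.inr ())) ≤ u + d} ∪
      Function.eval (.inl (.inr ())) ⁻¹' {x | d ≤ |x - 0|} := by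
    intro z hz
    by_cases h : d ≤ |z (.inl (.inr ())) - 0|
    · exact Or.inr h
    · left
      have h1 : entryCubeMin (fun p => z (.inl (.inl p))) < u := hz
      have h2 := le_abs_self (z (.inl (.inr ())) - 0)
      simp only [Set.mem_ofPred_eq]
      linarith
  have s2 : {z : (Fin m × Fin n ⊕ Unit) ⊕ (Fin m ⊕ Fin n) → ℝ |
      ‖WithLp.toLp 2 fun i => z (.inr (.inl i))‖ -
        (∑ j, |z (.inr (.inr j))|) / √(n : ℝ) ≤ u + d} ⊆
      ((fun z i => z (.inr (.inl i))) ⁻¹' {z | d ≤ |‖WithLp.toLp 2 z‖ - chiMean m|}) ∪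
      ((fun z j => z (.inr (.inr j))) ⁻¹'
        {z | √(n : ℝ) * d ≤ |∑ j, |z j| - n * √(2 / Real.pi)|}) := by
    intro z hz
    by_contra hc
    simp only [Set.mem_union, Set.mem_preimage, Set.mem_ofPred_eq, not_or, not_le] at hc hz
    obtain ⟨hc1, hc2⟩ := hc
    have h1 := neg_abs_le (‖WithLp.toLp 2 fun i => z (.inr (.inl i))‖ - chiMean m)
    have h2 := (le_abs_self _).trans_lt hc2
    have h3 : (∑ j, |z (.inr (.inr j))|) / √(n : ℝ) < √(n : ℝ) * √(2 / Real.pi) + d := by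
      rw [div_lt_iff₀ hsn]
      calc _ < n * √(2 / Real.pi) + √(n : ℝ) * d := by linarith
        _ = √(n : ℝ) * √(n : ℝ) * √(2 / Real.pi) + √(n : ℝ) * d := by rw [hs2]
        _ = _ := by ring
    linarith
  have t1 := (measureReal_mono s1 (μ := γ)).trans (measureReal_union_le _ _)
  have t2 := (measureReal_mono s2 (μ := γ)).trans (measureReal_union_le _ _)
  have e : 3 / d ^ 2 = 1 / d ^ 2 + 1 / d ^ 2 + 1 / d ^ 2 := by ring
  rw [e]
  change γ.real _ = _ at c1 c2 c3
  change (stdGaussianPi (Fin m)).real {z | d ≤ |‖WithLp.toLp 2 z‖ - chiMean m|} ≤ _ at b1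
  linarith

/-! ### Transfer to an arbitrary probability space. -/

namespace IsStdGaussianMatrix

variable {Ω : Type*} [MeasurableSpace Ω] {m n : ℕ} {H : Ω → Matrix (Fin m) (Fin n) ℝ}
  {P : Measure Ω}

theorem aemeasurable_entries (hH : IsStdGaussianMatrix H P) :
    AEMeasurable (fun ω (p : Fin m × Fin n) => H ω p.1 p.2) P :=
  aemeasurable_pi_lambda _ fun p => (hH.law p.1 p.2).aemeasurable

theorem map_entries (hH : IsStdGaussianMatrix H P) :
    P.map (fun ω (p : Fin m × Fin n) => H ω p.1 p.2) = stdGaussianPi (Fin m × Fin n) := by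
  refine (hH.indep.map_fun_eq_pi_map fun p : Fin m × Fin n => (hH.law p.1 p.2).aemeasurable).trans ?_
  congr 1
  ext1 p
  exact (hH.law p.1 p.2).map_eq

theorem integrable_cubeMin (hH : IsStdGaussianMatrix H P) :
    Integrable (fun ω => cubeMin (H ω)) P := by
  have h := integrable_entryCubeMin m n
  rw [← hH.map_entries] at h
  exact h.comp_aemeasurable hH.aemeasurable_entries

theorem integral_cubeMin (hH : IsStdGaussianMatrix H P) :
    ∫ ω, cubeMin (H ω) ∂P = ∫ z, entryCubeMin z ∂(stdGaussianPi (Fin m × Fin n)) := by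
  rw [← hH.map_entries, integral_map hH.aemeasurable_entries
    measurable_entryCubeMin.aestronglyMeasurable]
  rfl

theorem measure_le_cubeMin (hH : IsStdGaussianMatrix H P) (u : ℝ) :
    P {ω | u ≤ cubeMin (H ω)} = stdGaussianPi (Fin m × Fin n) {z | u ≤ entryCubeMin z} := by
  rw [← hH.map_entries, Measure.map_apply_of_aemeasurable hH.aemeasurable_entries
    (measurableSet_le measurable_const measurable_entryCubeMin)]
  rfl

theorem le_measure_le_cubeMin (hH : IsStdGaussianMatrix H P) (hm : 0 < m) (hn : 0 < n) {u d : ℝ}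
    (hd : 0 < d)
    (hu : u + 3 * d ≤ √(m : ℝ) - 1 / (4 * √(m : ℝ)) - √(n : ℝ) * √(2 / Real.pi)) :
    ENNReal.ofReal (1 - 3 / d ^ 2) ≤ P {ω | u ≤ cubeMin (H ω)} := by
  rw [hH.measure_le_cubeMin]
  refine ENNReal.ofReal_le_of_le_toReal ?_
  have h := measureReal_entryCubeMin_lt_le hm hn hd hu
  have hc := probReal_compl_eq_one_sub (μ := stdGaussianPi (Fin m × Fin n))
    (s := {z | entryCubeMin z < u}) (measurableSet_lt measurable_entryCubeMin measurable_const)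
  simp only [Set.compl_ofPred, not_lt] at hc
  rw [← measureReal_def, hc]
  linarith

theorem le_integral_cubeMin_div (hH : IsStdGaussianMatrix H P) (hm : 0 < m) (hn : 0 < n) :
    √((m : ℝ) / (n : ℝ)) - 1 / (4 * √((m : ℝ) * (n : ℝ))) - √(2 / Real.pi)
      ≤ (∫ ω, cubeMin (H ω) ∂P) / √(n : ℝ) := by
  have hsn : 0 < √(n : ℝ) := Real.sqrt_pos.2 (by exact_mod_cast hn)
  have hsm : 0 < √(m : ℝ) := Real.sqrt_pos.2 (by exact_mod_cast hm)
  rw [hH.integral_cubeMin, le_div_iff₀ hsn, Real.sqrt_div (Nat.cast_nonneg m),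
    Real.sqrt_mul (Nat.cast_nonneg m)]
  calc _ = √(m : ℝ) - 1 / (4 * √(m : ℝ)) - √(n : ℝ) * √(2 / Real.pi) := by field_simp
    _ ≤ chiMean m - √(n : ℝ) * √(2 / Real.pi) := by linarith [le_chiMean hm]
    _ ≤ _ := le_integral_entryCubeMin hn

end IsStdGaussianMatrix

/-! ### The limit and the main theorem. -/

theorem tendsto_measure_le_cubeMin {α : ℝ} (hα : 0 < α)
    {m n : ℕ → ℕ} (hn : Tendsto n atTop atTop)
    (hm : Tendsto (fun k => (m k : ℝ) / (n k : ℝ)) atTop (𝓝 α))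
    {Ω : ℕ → Type*} [∀ k, MeasurableSpace (Ω k)]
    {P : ∀ k, Measure (Ω k)} [∀ k, IsProbabilityMeasure (P k)]
    {H : ∀ k, Ω k → Matrix (Fin (m k)) (Fin (n k)) ℝ}
    (hH : ∀ k, IsStdGaussianMatrix (H k) (P k)) {ε : ℝ} (hε : 0 < ε) {u : ℕ → ℝ}
    (hu : ∀ᶠ k in atTop, u k / √(n k : ℝ) < √α - √(2 / Real.pi) - ε) :
    Tendsto (fun k => P k {ω | u k ≤ cubeMin (H k ω)}) atTop (𝓝 1) := by
  have hsn : Tendsto (fun k => √(n k : ℝ)) atTop atTop :=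
    Real.tendsto_sqrt_atTop.comp (tendsto_natCast_atTop_atTop.comp hn)
  have hroot : Tendsto (fun k => √((m k : ℝ) / (n k : ℝ))) atTop (𝓝 √α) :=
    (Real.continuous_sqrt.tendsto α).comp hm
  -- The deviation is `d = (ε/6)√n`, so `3 d` uses half of the margin `ε√n`.
  have hlow : Tendsto (fun k => ENNReal.ofReal (1 - 3 / (ε / 6 * √(n k : ℝ)) ^ 2)) atTop (𝓝 1) := by
    have h1 : Tendsto (fun k => (ε / 6 * √(n k : ℝ)) ^ 2) atTop atTop :=
      (tendsto_pow_atTop two_ne_zero).comp (hsn.const_mul_atTop (by positivity))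
    have h2 := (h1.const_div_atTop (3 : ℝ)).const_sub 1
    rw [sub_zero] at h2
    simpa using ENNReal.tendsto_ofReal h2
  refine tendsto_of_tendsto_of_tendsto_of_le_of_le' hlow tendsto_const_nhds ?_
    (Eventually.of_forall fun k => prob_le_one)
  -- The other half of `ε√n` is split between `√m` against `√α √n`, and `1/(4√m) ≤ 1/4 ≤ ε√n/4`,
  -- which needs `√n ≥ 1/ε`.
  filter_upwards [hu, hroot.eventually (lt_mem_nhds (show √α - ε / 4 < √α by linarith)),
    hm.eventually (lt_mem_nhds hα), hn.eventually_ge_atTop 1,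
    hsn.eventually_ge_atTop (1 / ε)] with k h1 h2 h3 h4 h5
  have hn0 : 0 < n k := h4
  have hm0 : 0 < m k := by
    rcases Nat.eq_zero_or_pos (m k) with h | h
    · simp [h] at h3
    · exact h
  have hs : 0 < √(n k : ℝ) := Real.sqrt_pos.2 (by exact_mod_cast hn0)
  have hsm : 1 ≤ √(m k : ℝ) := Real.one_le_sqrt.2 (by exact_mod_cast hm0)
  refine (hH k).le_measure_le_cubeMin hm0 hn0 (by positivity) ?_
  rw [div_lt_iff₀ hs] at h1
  rw [Real.sqrt_div (Nat.cast_nonneg _), lt_div_iff₀ hs] at h2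
  rw [div_le_iff₀ hε] at h5
  have h6 : 1 / (4 * √(m k : ℝ)) ≤ 1 / 4 := by
    rw [div_le_div_iff₀ (by positivity) (by norm_num)]
    linarith
  nlinarith

theorem mainTheorem3 (α : ℝ) (hα : 0 < α)
    (m n : ℕ → ℕ) (hn : Tendsto n atTop atTop)
    (hm : Tendsto (fun k => (m k : ℝ) / (n k : ℝ)) atTop (𝓝 α))
    {Ω : ℕ → Type*} [∀ k, MeasurableSpace (Ω k)]
    (P : ∀ k, Measure (Ω k)) [∀ k, IsProbabilityMeasure (P k)]
    (H : ∀ k, Ω k → Matrix (Fin (m k)) (Fin (n k)) ℝ)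
    (hH : ∀ k, IsStdGaussianMatrix (H k) (P k)) :
    (∀ ε₁ ε₂ ε₃ : ℝ, 0 < ε₁ → 0 < ε₂ → 0 < ε₃ → ∀ ξl : ℕ → ℝ,
      (∀ᶠ k in atTop,
        ξl k / √(n k : ℝ) < (1 - ε₁) * √α - (1 + ε₂) * √(2 / Real.pi) - ε₃) →
      Tendsto (fun k => P k {ω | ξl k ≤ cubeMin (H k ω)}) atTop (𝓝 1) ∧
      ((∀ᶠ k in atTop, 0 ≤ ξl k) →
        Tendsto (fun k => P k {ω | ξl k ^ 2 ≤ cubeMin (H k ω) ^ 2}) atTop (𝓝 1))) ∧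
    (∀ k, 0 < m k → 0 < n k →
      Integrable (fun ω => cubeMin (H k ω)) (P k) ∧
      √((m k : ℝ) / (n k : ℝ)) - 1 / (4 * √((m k : ℝ) * (n k : ℝ))) - √(2 / Real.pi)
        ≤ (∫ ω, cubeMin (H k ω) ∂(P k)) / √(n k : ℝ) ∧
      ((m k : ℝ) = α * (n k : ℝ) →
        √α - 1 / (4 * √((m k : ℝ) * (n k : ℝ))) - √(2 / Real.pi)
          ≤ (∫ ω, cubeMin (H k ω) ∂(P k)) / √(n k : ℝ))) := by
  refine ⟨fun ε₁ ε₂ ε₃ h1 h2 h3 ξl hξ => ?_, fun k hm0 hn0 => ?_⟩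
  · have hlim : Tendsto (fun k => P k {ω | ξl k ≤ cubeMin (H k ω)}) atTop (𝓝 1) := by
      refine tendsto_measure_le_cubeMin hα hn hm hH h3 (hξ.mono fun k hk => ?_)
      -- The terms `ε₁√α` and `ε₂√(2/π)` only lower the threshold, so `ε₃` can serve as the margin.
      nlinarith [mul_nonneg h1.le (Real.sqrt_nonneg α),
        mul_nonneg h2.le (Real.sqrt_nonneg (2 / Real.pi))]
    refine ⟨hlim, fun h0 => ?_⟩
    refine tendsto_of_tendsto_of_tendsto_of_le_of_le' hlim tendsto_const_nhds ?_
      (Eventually.of_forall fun k => prob_le_one)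
    filter_upwards [h0] with k hk
    exact measure_mono fun ω hω => pow_le_pow_left₀ hk hω 2
  · have h := (hH k).le_integral_cubeMin_div hm0 hn0
    refine ⟨(hH k).integrable_cubeMin, h, fun he => ?_⟩
    have hn1 : (n k : ℝ) ≠ 0 := by exact_mod_cast hn0.ne'
    have e : (m k : ℝ) / n k = α := by rw [he]; field_simp
    rwa [e] at h
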